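/- Throughout, structures are finite, with nonempty domain. Fix a schema $\mathcal S$ (finitely many relation symbols, each of arity at least $1$) and $k\ge 0$. A structure over $\mathcal S$ with $k$ distinguished elements is a pair $(A,\mathbf a)$ of a structure $A$ over $\mathcal S$ and a $k$-tuple $\mathbf a$ of (not necessarily different) elements of its domain. We write $(A,\mathbf a)\to(B,\mathbf b)$ if some map $h:\mathrm{dom}(A)\to\mathrm{dom}(B)$ preserves all facts and satisfies $h(a_i)=b_i$ for $i=1,\dots,k$. The incidence graph of $(A,\mathbf a)$ is the bipartite multigraph whose nodes are the elements and the facts of $A$, with one edge between an element and a fact for each occurrence of the element in the fact; $(A,\mathbf a)$ is c-acyclic if every cycle of its incidence graph (two parallel edges count as a cycle) contains at least one of $a_1,\dots,a_k$. A frontier for $(A,\mathbf a)$ with respect to a class $\mathcal C$ of structures with $k$ distinguished elements is a set $F$ of such structures with the following properties: 1. $(B,\mathbf b)\to(A,\mathbf a)$ for all $(B,\mathbf b)\in F$; 2. $(A,\mathbf a)\not\to(B,\mathbf b)$ for all $(B,\mathbf b)\in F$; 3. for every $(C,\mathbf c)\in\mathcal C$ with $(C,\mathbf c)\to(A,\mathbf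 a)$ and $(A,\mathbf a)\not\to(C,\mathbf c)$ there is $(B,\mathbf b)\in F$ with $(C,\mathbf c)\to(B,\mathbf b)$. **Theorem.** For every schema $\mathcal S$ and every $k\ge 0$ there is an algorithm that, given a c-acyclic structure $(A,\mathbf a)$ over $\mathcal S$ with $k$ distinguished elements (as a list of its elements, its facts and its distinguished elements), computes in time polynomial in the size of the input a finite frontier for $(A,\mathbf a)$ with respect to the class of all structures over $\mathcal S$ with $k$ distinguished elements. -/

import Mathlib

/-! ### Finite relational structures with distinguished elements -/

/-- A schema: finitely many relation symbols, each with a positive arity. -/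
structure Schema where
  numRel : ℕ
  arity : Fin numRel → ℕ
  arity_pos : ∀ r, 0 < arity r

/-- `R(t)` as a pair of a relation symbol and a tuple over `α` of the right length. -/
abbrev Schema.Atom (S : Schema) (α : Type) : Type :=
  Σ r : Fin S.numRel, (Fin (S.arity r) → α)

/-- A finite structure (with nonempty domain) over `S` with `k` distinguished elements,
which need not be pairwise different. -/
structure Str (S : Schema) (k : ℕ) where
  dom : Type
  finite_dom : Finite dom
  nonempty_dom : Nonempty dom
  rel : ∀ r : Fin S.numRel, Set (Fin (S.arity r) → dom)
  pt : Fin k → dom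

namespace Str

variable {S : Schema} {k : ℕ}

/-- `(A, a) → (B, b)`: some map preserves all facts and the distinguished elements. -/
def MapsTo (A B : Str S k) : Prop :=
  ∃ h : A.dom → B.dom,
    (∀ i, h (A.pt i) = B.pt i) ∧ ∀ r, ∀ t ∈ A.rel r, (fun p => h (t p)) ∈ B.rel r

/-- The facts of a structure. -/
def Fact (A : Str S k) : Type :=
  {f : S.Atom A.dom // f.2 ∈ A.rel f.1}

/-- The element `a` occurs in the fact `f`. -/
def Occurs (A : Str S k) (a : A.dom) (f : A.Fact) : Prop :=
  ∃ p, f.1.2 p = a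

/-- The simple graph that underlies the incidence multigraph: its nodes are the elements and the
facts, and an element is joined to each fact in which it occurs. -/
def incidenceGraph (A : Str S k) : SimpleGraph (A.dom ⊕ A.Fact) :=
  SimpleGraph.fromRel fun u v => ∃ a f, u = Sum.inl a ∧ v = Sum.inr f ∧ A.Occurs a f

/-- Every cycle of the incidence multigraph (one edge for each occurrence of an element in a fact)
contains a distinguished element. A cycle of this multigraph is either a pair of parallel edges,
that is, an element with two occurrences in one fact, or a cycle of the underlying simple graph. -/
def CAcyclic (A : Str S k) : Prop :=
  (∀ f : A.Fact, ∀ p q, p ≠ q → f.1.2 p = f.1.2 q → ∃ i, A.pt i = f.1.2 p) ∧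
  ∀ (v : A.dom ⊕ A.Fact) (w : A.incidenceGraph.Walk v v), w.IsCycle →
    ∃ i, Sum.inl (A.pt i) ∈ w.support

/-- `F` is a frontier for `A` with respect to the class `𝒞`. -/
def IsFrontier (𝒞 F : Set (Str S k)) (A : Str S k) : Prop :=
  (∀ B ∈ F, B.MapsTo A) ∧
  (∀ B ∈ F, ¬ A.MapsTo B) ∧
  ∀ C ∈ 𝒞, C.MapsTo A → ¬ A.MapsTo C → ∃ B ∈ F, C.MapsTo B

end Str

/-! ### Data and their encoding -/

/-- The data on which programs operate: binary trees. -/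
inductive Data where
  | nil : Data
  | cons : Data → Data → Data

namespace Data

/-- The number of nodes. -/
def size : Data → ℕ
  | nil => 1
  | cons a b => a.size + b.size + 1

/-- Numbers in unary. -/
def ofNat : ℕ → Data
  | 0 => nil
  | n + 1 => cons nil (ofNat n)

def ofList : List Data → Data
  | [] => nil
  | a :: l => cons a (ofList l)

end Data

/-- An explicit description of a finite structure: the domain `{0, …, n - 1}`, a list of all
facts, and the tuple of distinguished elements. -/
structure Presentation (S : Schema) (k : ℕ) where
  n : ℕ
  n_pos : 0 < n
  facts : List (S.Atom (Fin n))
  pt : Fin k → Fin n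

namespace Presentation

variable {S : Schema} {k : ℕ}

/-- The structure that is described. -/
def toStr (P : Presentation S k) : Str S k where
  dom := Fin P.n
  finite_dom := inferInstance
  nonempty_dom := ⟨⟨0, P.n_pos⟩⟩
  rel r := {t | (⟨r, t⟩ : S.Atom (Fin P.n)) ∈ P.facts}
  pt := P.pt

/-- The description as a datum; its size is polynomial in the domain size, the number of listed
facts and `k`. -/
def encode (P : Presentation S k) : Data :=
  .cons (.ofNat P.n) (.cons
    (.ofList (P.facts.map fun f =>
      .cons (.ofNat f.1) (.ofList (List.ofFn fun p => .ofNat (f.2 p)))))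
    (.ofList (List.ofFn fun i => .ofNat (P.pt i))))

end Presentation

/-! ### Programs and running time -/

/-- While programs over binary trees, in combinator form. -/
inductive Program where
  /-- return `nil` -/
  | nil : Program
  /-- return the input -/
  | id : Program
  /-- return the left subtree (`nil` on `nil`) -/
  | fst : Program
  /-- return the right subtree (`nil` on `nil`) -/
  | snd : Program
  /-- run both programs on the input and join the results -/
  | pair : Program → Program → Program
  /-- run the first program on the input, and the second one on its result -/
  | seq : Program → Program → Program
  /-- run the first program as a test; if its result is not `nil`, run the second program on the
  input, otherwise the third -/
  | ite : Program → Program → Program → Program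
  /-- as long as the first program does not return `nil` on the current datum, replace this
  datum by the result of the second program -/
  | loop : Program → Program → Program

namespace Program

/-- `Runs p x y t`: on input `x` the program `p` halts with output `y` after `t` elementary steps.
A basic instruction takes as many steps as are needed to read its whole input node by node,
so copying is never free, and the time bounds the size of every datum that occurs
(`Runs.size_lt` and `Runs.size_le`). Hence a Turing machine can simulate `t` steps in time
polynomial in `t`, and conversely programs simulate Turing machines with polynomial overhead. -/
inductive Runs : Program → Data → Data → ℕ → Prop
  | nil (x) : Runs .nil x .nil (x.size + 1)
  | id (x) : Runs .id x x (x.size + 1)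
  | fst_nil : Runs .fst .nil .nil (Data.nil.size + 1)
  | fst_cons (a b) : Runs .fst (.cons a b) a ((Data.cons a b).size + 1)
  | snd_nil : Runs .snd .nil .nil (Data.nil.size + 1)
  | snd_cons (a b) : Runs .snd (.cons a b) b ((Data.cons a b).size + 1)
  | pair {p q x y z s t} : Runs p x y s → Runs q x z t →
      Runs (.pair p q) x (.cons y z) (s + t + 1)
  | seq {p q x y z s t} : Runs p x y s → Runs q y z t → Runs (.seq p q) x z (s + t + 1)
  | ite_true {c p q x a b y s t} : Runs c x (.cons a b) s → Runs p x y t →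
      Runs (.ite c p q) x y (s + t + 1)
  | ite_false {c p q x y s t} : Runs c x .nil s → Runs q x y t →
      Runs (.ite c p q) x y (s + t + 1)
  | loop_stop {c p x s} : Runs c x .nil s → Runs (.loop c p) x x (s + 1)
  | loop_step {c p x a b y z s t u} : Runs c x (.cons a b) s → Runs p x y t →
      Runs (.loop c p) y z u → Runs (.loop c p) x z (s + t + u + 1)

/-- The time exceeds the size of the input. -/
theorem Runs.size_lt {p : Program} {x y : Data} {t : ℕ} (h : Runs p x y t) : x.size < t := by
  induction h <;> omega

/-- The time bounds the size of the output. -/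
theorem Runs.size_le {p : Program} {x y : Data} {t : ℕ} (h : Runs p x y t) : y.size ≤ t := by
  induction h with
  | loop_stop h _ => exact h.size_lt.le.trans (Nat.le_succ _)
  | nil | fst_cons | snd_cons | pair => simp only [Data.size] at *; omega
  | _ => omega

/-- Programs are deterministic, in output and in time. -/
theorem Runs.unique {p : Program} {x y : Data} {t : ℕ} (h : Runs p x y t) :
    ∀ {z : Data} {u : ℕ}, Runs p x z u → y = z ∧ t = u := by
  induction h with
  | nil | id | fst_nil | fst_cons | snd_nil | snd_cons => intro z u h; cases h; exact ⟨rfl, rfl⟩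
  | pair _ _ ih₁ ih₂ =>
    intro z u h
    cases h with
    | pair h₁ h₂ =>
      obtain ⟨rfl, rfl⟩ := ih₁ h₁
      obtain ⟨rfl, rfl⟩ := ih₂ h₂
      exact ⟨rfl, rfl⟩
  | seq _ _ ih₁ ih₂ =>
    intro z u h
    cases h with
    | seq h₁ h₂ =>
      obtain ⟨rfl, rfl⟩ := ih₁ h₁
      obtain ⟨rfl, rfl⟩ := ih₂ h₂
      exact ⟨rfl, rfl⟩
  | ite_true _ _ ih₁ ih₂ =>
    intro z u h
    cases h with
    | ite_true h₁ h₂ =>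
      obtain ⟨_, rfl⟩ := ih₁ h₁
      obtain ⟨rfl, rfl⟩ := ih₂ h₂
      exact ⟨rfl, rfl⟩
    | ite_false h₁ _ => exact absurd (ih₁ h₁).1 (by simp)
  | ite_false _ _ ih₁ ih₂ =>
    intro z u h
    cases h with
    | ite_true h₁ _ => exact absurd (ih₁ h₁).1 (by simp)
    | ite_false h₁ h₂ =>
      obtain ⟨_, rfl⟩ := ih₁ h₁
      obtain ⟨rfl, rfl⟩ := ih₂ h₂
      exact ⟨rfl, rfl⟩
  | loop_stop _ ih =>
    intro z u h
    cases h with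
    | loop_stop h₁ => obtain ⟨_, rfl⟩ := ih h₁; exact ⟨rfl, rfl⟩
    | loop_step h₁ _ _ => exact absurd (ih h₁).1 (by simp)
  | loop_step _ _ _ ih₁ ih₂ ih₃ =>
    intro z u h
    cases h with
    | loop_stop h₁ => exact absurd (ih₁ h₁).1 (by simp)
    | loop_step h₁ h₂ h₃ =>
      obtain ⟨_, rfl⟩ := ih₁ h₁
      obtain ⟨rfl, rfl⟩ := ih₂ h₂
      obtain ⟨rfl, rfl⟩ := ih₃ h₃
      exact ⟨rfl, rfl⟩

end Program

/-!
The algorithm first shrinks the list of facts of `A` to a minimal one that still admits a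
homomorphism from `A`, and then writes down an explicit frontier of the structure that remains.

*Homomorphism tests.* On a structure that is c-acyclic, the arc consistency procedure decides the
existence of homomorphisms: it starts with all pairs of an element of the source and an element of
the target that respect the distinguished elements, and removes a pair `(a, c)`, with `a` not
distinguished, as long as some fact containing `a` has no image that has `c` in the right place and
uses only pairs that are left. If each fact still has an image among the pairs that are left, a
homomorphism is obtained by adding leaf facts one by one (`Str.IsForest.mapsTo`). So facts can be
dropped greedily, and every endomorphism of the result permutes its facts
(`Presentation.exists_core`).

*The frontier.* Let `A` be minimal in this sense. A structure `C` that maps to `A` but fails an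
equality between distinguished elements of `A` maps to some `A.split τ`, in which each element of
`A` is doubled and equal distinguished elements may be moved apart. If `C` respects the equalities
and `A` does not map to `C`, arc consistency leaves a fact `f₀` without an image, and all pairs of
the elements of `f₀` that are not distinguished, and of the elements connected to them, are removed.
An element `c` above such an element `a` is labeled by the fact that causes the removal of `(a, c)`.
In a fact of `C` above the fact `f` of `A`, the pair that is removed first is not removed because of
`f`, since at that time the fact of `C` itself is still an image of `f`. Hence `C` maps to
`A.obstructed f₀`, the structure of labeled elements of `A` in which a copy of `f` must carry some
label other than `f` (`Str.IsForest.exists_mapsTo_obstructed`); an element of `C` that is above a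
distinguished element of `A` without being its counterpart is sent to a substitute, whose presence in
a fact lifts this restriction. Conversely, a homomorphism from `A` to `A.obstructed f₀`
yields, after composition with a power of the induced automorphism, a label for each element of `A`.
Going from `f₀` to an element that is not labeled by it, to the label of this element, and so on,
one gets an infinite walk without backtracking that avoids distinguished elements, which is
impossible in a c-acyclic structure (`Str.IsForest.not_mapsTo_obstructed`).

*Running time.* Programs are obtained from combinators for functions on encoded data that preserve
computability in polynomial time; the only source of iteration is the fold over a list whose
intermediate values have polynomial size (`PolyTime.foldl`). As arities and the number of
distinguished elements are fixed, all labelings of a fact can be listed in polynomial time.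
-/

/-! ### Polynomial-time functions on encoded data -/

/-- Types whose elements are represented by binary trees. -/
class ToData (α : Type) where
  toData : α → Data

open ToData

instance : ToData ℕ := ⟨Data.ofNat⟩
instance : ToData Unit := ⟨fun _ => .nil⟩
instance : ToData Bool := ⟨fun b => bif b then .cons .nil .nil else .nil⟩
instance {α β : Type} [ToData α] [ToData β] : ToData (α × β) :=
  ⟨fun x => .cons (toData x.1) (toData x.2)⟩
instance {α : Type} [ToData α] : ToData (List α) := ⟨fun l => .ofList (l.map toData)⟩

/-- The size of the tree that represents `a`. -/
def codeSize {α : Type} [ToData α] (a : α) : ℕ := (toData a).size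

/-- Some program computes `f` on representations, in a time that is bounded by a polynomial in the
size of the input. -/
def PolyTime {α β : Type} [ToData α] [ToData β] (f : α → β) : Prop :=
  ∃ (p : Program) (b : Polynomial ℕ), ∀ a, ∃ t,
    p.Runs (toData a) (toData (f a)) t ∧ t ≤ b.eval (codeSize a)

theorem Polynomial.eval_nat_mono (p : Polynomial ℕ) : Monotone fun n => p.eval n := by
  intro m n h
  simp only [Polynomial.eval_eq_sum_range]
  gcongr

section

variable {α β γ δ : Type} [ToData α] [ToData β] [ToData γ] [ToData δ]

@[simp] theorem codeSize_pair (a : α) (b : β) :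
    codeSize (a, b) = codeSize a + codeSize b + 1 := rfl

@[simp] theorem codeSize_nil : codeSize ([] : List α) = 1 := rfl

@[simp] theorem codeSize_cons (a : α) (l : List α) :
    codeSize (a :: l) = codeSize a + codeSize l + 1 := rfl

@[simp] theorem codeSize_succ (n : ℕ) : codeSize (n + 1) = codeSize n + 2 := by
  simp only [codeSize, toData, Data.ofNat, Data.size]; omega

@[simp] theorem codeSize_zero : codeSize 0 = 1 := rfl

theorem codeSize_nat (n : ℕ) : codeSize n = 2 * n + 1 := by
  induction n with
  | zero => rfl
  | succ n ih => rw [codeSize_succ, ih]; ring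

theorem codeSize_bool (b : Bool) : codeSize b ≤ 3 := by
  cases b <;> simp [codeSize, toData, Data.size]

theorem codeSize_append (l₁ l₂ : List α) :
    codeSize (l₁ ++ l₂) + 1 = codeSize l₁ + codeSize l₂ := by
  induction l₁ with
  | nil => simp [add_comm]
  | cons a l ih => simp only [List.cons_append, codeSize_cons]; omega

theorem codeSize_le_of_mem {a : α} {l : List α} (h : a ∈ l) : codeSize a ≤ codeSize l := by
  induction l with
  | nil => simp at h
  | cons b l ih =>
    rcases List.mem_cons.1 h with rfl | h
    · simp only [codeSize_cons]; omega
    · have := ih h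
      simp only [codeSize_cons]; omega

theorem codeSize_le_of_sublist {l₁ l₂ : List α} (h : l₁.Sublist l₂) :
    codeSize l₁ ≤ codeSize l₂ := by
  induction h with
  | slnil => exact le_rfl
  | cons a _ ih => simp only [codeSize_cons]; omega
  | cons_cons a _ ih => simp only [codeSize_cons]; omega

theorem length_le_codeSize (l : List α) : l.length ≤ codeSize l := by
  induction l with
  | nil => simp
  | cons a l ih => simp only [codeSize_cons, List.length_cons]; omega

namespace PolyTime

theorem size_le {f : α → β} (hf : PolyTime f) :
    ∃ D : Polynomial ℕ, ∀ a, codeSize (f a) ≤ D.eval (codeSize a) := by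
  obtain ⟨p, b, h⟩ := hf
  refine ⟨b, fun a => ?_⟩
  obtain ⟨t, ht, hb⟩ := h a
  exact ht.size_le.trans hb

/-- The values of `f` on the members of a list that is computed in polynomial time have
polynomial size. -/
theorem size_le_of_mem {l : γ → List α} {f : γ → α → β} (hl : PolyTime l)
    (hf : PolyTime fun x : γ × α => f x.1 x.2) :
    ∃ D : Polynomial ℕ, ∀ c, ∀ a ∈ l c, codeSize (f c a) ≤ D.eval (codeSize c) := by
  obtain ⟨D, hD⟩ := hf.size_le
  obtain ⟨E, hE⟩ := hl.size_le
  refine ⟨D.comp (.X + E + 1), fun c a ha => (hD (c, a)).trans ?_⟩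
  simp only [Polynomial.eval_comp, Polynomial.eval_add, Polynomial.eval_X, Polynomial.eval_one]
  apply D.eval_nat_mono
  have := (codeSize_le_of_mem ha).trans (hE c)
  rw [codeSize_pair]; omega

theorem id : PolyTime fun a : α => a :=
  ⟨.id, .X + 1, fun a => ⟨_, .id _, by simp [codeSize]⟩⟩

theorem comp {g : β → γ} {f : α → β} (hg : PolyTime g) (hf : PolyTime f) :
    PolyTime fun a => g (f a) := by
  obtain ⟨p, b, hp⟩ := hf
  obtain ⟨q, c, hq⟩ := hg
  refine ⟨.seq p q, b + c.comp b + 1, fun a => ?_⟩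
  obtain ⟨t, ht, htb⟩ := hp a
  obtain ⟨u, hu, huc⟩ := hq (f a)
  refine ⟨_, .seq ht hu, ?_⟩
  have := c.eval_nat_mono (ht.size_le.trans htb)
  simp only [Polynomial.eval_add, Polynomial.eval_comp, Polynomial.eval_one]
  simp only [codeSize] at *
  omega

theorem pair {f : α → β} {g : α → γ} (hf : PolyTime f) (hg : PolyTime g) :
    PolyTime fun a => (f a, g a) := by
  obtain ⟨p, b, hp⟩ := hf
  obtain ⟨q, c, hq⟩ := hg
  refine ⟨.pair p q, b + c + 1, fun a => ?_⟩
  obtain ⟨t, ht, htb⟩ := hp a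
  obtain ⟨u, hu, huc⟩ := hq a
  refine ⟨_, .pair ht hu, ?_⟩
  simp only [Polynomial.eval_add, Polynomial.eval_one]
  omega

theorem fst {f : α → β × γ} (hf : PolyTime f) : PolyTime fun a => (f a).1 :=
  comp (g := Prod.fst) ⟨.fst, .X + 1, fun _ => ⟨_, .fst_cons _ _, by
    simp [codeSize, toData]⟩⟩ hf

theorem snd {f : α → β × γ} (hf : PolyTime f) : PolyTime fun a => (f a).2 :=
  comp (g := Prod.snd) ⟨.snd, .X + 1, fun _ => ⟨_, .snd_cons _ _, by
    simp [codeSize, toData]⟩⟩ hf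

/-- A function that acts on trees like the identity is computed in polynomial time. -/
theorem of_toData_eq {f : α → β} {g : β → γ} (hf : PolyTime f)
    (h : ∀ b, toData (g b) = toData b) : PolyTime fun a => g (f a) := by
  obtain ⟨p, b, hp⟩ := hf
  refine ⟨p, b, fun a => ?_⟩
  simpa only [h] using hp a

theorem const (y : β) : PolyTime fun _ : α => y := by
  have key : ∀ d : Data, ∃ (p : Program) (b : Polynomial ℕ), ∀ x : Data, ∃ t,
      p.Runs x d t ∧ t ≤ b.eval x.size := by
    intro d
    induction d with
    | nil => exact ⟨.nil, .X + 1, fun x => ⟨_, .nil x, by simp⟩⟩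
    | cons d e ihd ihe =>
      obtain ⟨p, b, hp⟩ := ihd
      obtain ⟨q, c, hq⟩ := ihe
      refine ⟨.pair p q, b + c + 1, fun x => ?_⟩
      obtain ⟨t, ht, htb⟩ := hp x
      obtain ⟨u, hu, huc⟩ := hq x
      refine ⟨_, .pair ht hu, ?_⟩
      simp only [Polynomial.eval_add, Polynomial.eval_one]
      omega
  obtain ⟨p, b, h⟩ := key (toData y)
  exact ⟨p, b, fun a => h _⟩

theorem ite {b : α → Bool} {f g : α → β} (hb : PolyTime b) (hf : PolyTime f) (hg : PolyTime g) :
    PolyTime fun a => if b a then f a else g a := by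
  obtain ⟨r, d, hr⟩ := hb
  obtain ⟨p, e, hp⟩ := hf
  obtain ⟨q, c, hq⟩ := hg
  refine ⟨.ite r p q, d + e + c + 1, fun a => ?_⟩
  obtain ⟨s, hs, hsb⟩ := hr a
  obtain ⟨t, ht, htb⟩ := hp a
  obtain ⟨u, hu, huc⟩ := hq a
  simp only [Polynomial.eval_add, Polynomial.eval_one]
  cases h : b a <;> rw [h] at hs
  · exact ⟨_, .ite_false hs hu, by omega⟩
  · exact ⟨_, .ite_true hs ht, by omega⟩

theorem listCases {l : γ → List α} {x : γ → β} {y : γ → α → List α → β} (hl : PolyTime l)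
    (hx : PolyTime x) (hy : PolyTime fun s : γ × α × List α => y s.1 s.2.1 s.2.2) :
    PolyTime fun c => match l c with
      | [] => x c
      | a :: t => y c a t := by
  obtain ⟨q, e, hq⟩ := hx
  obtain ⟨r, d, hr⟩ := hy
  obtain ⟨w, j, hw⟩ := id.pair hl
  obtain ⟨p, b, hp⟩ := hl
  refine ⟨.ite p (.seq w r) q, b + e + j + d.comp j + 2, fun c => ?_⟩
  obtain ⟨s, hs, hsb⟩ := hp c
  simp only [Polynomial.eval_add, Polynomial.eval_comp, Polynomial.eval_ofNat]
  cases h : l c with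
  | nil =>
    rw [h] at hs
    obtain ⟨t, ht, htb⟩ := hq c
    exact ⟨_, .ite_false hs ht, by omega⟩
  | cons a m =>
    rw [h] at hs
    obtain ⟨t, ht, htb⟩ := hw c
    simp only [h] at ht
    obtain ⟨u, hu, hub⟩ := hr (c, a, m)
    have : d.eval (codeSize (c, a, m)) ≤ _ := d.eval_nat_mono (ht.size_le.trans htb)
    simp only [codeSize] at *
    exact ⟨_, .ite_true hs (.seq ht hu), by omega⟩

/-- The running time of a loop that folds `step` over a list: the state consists of a context, the
value accumulated so far and the rest of the list, and `N` bounds the size of all states. -/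
theorem runs_loop {step : β → α → β} {p q : Program} {b d : Polynomial ℕ} {c : γ} {N : ℕ}
    (hp : ∀ l : List α, ∀ x : β, ∃ t,
      p.Runs (toData (c, x, l)) (toData l) t ∧ t ≤ b.eval (codeSize (c, x, l)))
    (hq : ∀ a, ∀ l : List α, ∀ x : β, ∃ t,
      q.Runs (toData (c, x, a :: l)) (toData (c, step x a, l)) t ∧
        t ≤ d.eval (codeSize (c, x, a :: l))) (l : List α) (x : β)
    (hN : ∀ l₁ l₂, l = l₁ ++ l₂ → codeSize (c, l₁.foldl step x, l₂) ≤ N) :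
    ∃ t, (Program.loop p q).Runs (toData (c, x, l)) (toData (c, l.foldl step x, ([] : List α))) t ∧
      t ≤ (l.length + 1) * (b.eval N + d.eval N + 1) := by
  induction l generalizing x with
  | nil =>
    obtain ⟨t, ht, htb⟩ := hp [] x
    have := b.eval_nat_mono (hN [] [] rfl)
    refine ⟨_, Program.Runs.loop_stop ht, ?_⟩
    simp only [List.foldl_nil] at this
    simp only [List.length_nil]
    omega
  | cons a l ih =>
    obtain ⟨t, ht, htb⟩ := hp (a :: l) x
    obtain ⟨u, hu, hub⟩ := hq a l x
    obtain ⟨v, hv, hvb⟩ := ih (step x a) fun l₁ l₂ h => hN (a :: l₁) l₂ (by simp [h])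
    refine ⟨_, .loop_step ht hu hv, ?_⟩
    have h₁ := b.eval_nat_mono (hN [] (a :: l) rfl)
    have h₂ := d.eval_nat_mono (hN [] (a :: l) rfl)
    simp only [List.foldl_nil] at h₁ h₂
    rw [List.length_cons, Nat.succ_mul]
    omega

theorem foldl {l : γ → List α} {init : γ → β} {step : γ → β → α → β} (hl : PolyTime l)
    (hi : PolyTime init) (hs : PolyTime fun x : γ × β × α => step x.1 x.2.1 x.2.2)
    (hB : ∃ B : Polynomial ℕ, ∀ c l₁, l₁ <+: l c →
      codeSize (l₁.foldl (step c) (init c)) ≤ B.eval (codeSize c)) :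
    PolyTime fun c => (l c).foldl (step c) (init c) := by
  obtain ⟨B, hB⟩ := hB
  obtain ⟨L, hL⟩ := hl.size_le
  have hbody : PolyTime fun s : γ × β × List α => match s.2.2 with
      | [] => s
      | a :: t => (s.1, step s.1 s.2.1 a, t) :=
    listCases (y := fun s a t => (s.1, step s.1 s.2.1 a, t)) id.snd.snd id
      (id.fst.fst.pair ((hs.comp (id.fst.fst.pair (id.fst.snd.fst.pair id.snd.fst))).pair
        id.snd.snd))
  obtain ⟨p, b, hp⟩ := (id (α := γ × β × List α)).snd.snd
  obtain ⟨q, d, hq⟩ := hbody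
  have hloop : PolyTime fun c => (c, (l c).foldl (step c) (init c), ([] : List α)) := by
    obtain ⟨r, e, hr⟩ := id.pair (hi.pair hl)
    let N : Polynomial ℕ := .X + B + L + 2
    refine ⟨.seq r (.loop p q), e + (L + 1) * (b.comp N + d.comp N + 1) + 1, fun c => ?_⟩
    obtain ⟨s, hs, hsb⟩ := hr c
    obtain ⟨t, ht, htb⟩ := runs_loop (step := step c) (N := N.eval (codeSize c))
      (fun l x => hp (c, x, l)) (fun a l x => hq (c, x, a :: l)) (l c) (init c) (by
        intro l₁ l₂ h
        have h₁ := hB c l₁ (h ▸ List.prefix_append _ _)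
        have h₂ := (codeSize_le_of_sublist (h ▸ List.sublist_append_right l₁ l₂)).trans (hL c)
        simp only [N, Polynomial.eval_add, Polynomial.eval_X, Polynomial.eval_ofNat, codeSize_pair]
        omega)
    refine ⟨_, .seq hs ht, ?_⟩
    simp only [Polynomial.eval_add, Polynomial.eval_mul, Polynomial.eval_comp, Polynomial.eval_one]
    have := Nat.mul_le_mul_right (b.eval (N.eval (codeSize c)) + d.eval (N.eval (codeSize c)) + 1)
      (Nat.succ_le_succ ((length_le_codeSize (l c)).trans (hL c)))
    simp only [Nat.succ_eq_add_one] at this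
    omega
  exact hloop.snd.fst

/-- A fold runs in polynomial time if each step increases the size of the state by at most a
polynomial in the size of the context. -/
theorem foldl_of_le {l : γ → List α} {init : γ → β} {step : γ → β → α → β} (hl : PolyTime l)
    (hi : PolyTime init) (hs : PolyTime fun x : γ × β × α => step x.1 x.2.1 x.2.2)
    (hD : ∃ D : Polynomial ℕ, ∀ c x, ∀ a ∈ l c,
      codeSize (step c x a) ≤ codeSize x + D.eval (codeSize c)) :
    PolyTime fun c => (l c).foldl (step c) (init c) := by
  obtain ⟨D, hD⟩ := hD
  obtain ⟨L, hL⟩ := hl.size_le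
  obtain ⟨I, hI⟩ := hi.size_le
  refine foldl hl hi hs ⟨I + L * D, fun c l₁ h => ?_⟩
  have key : ∀ (m : List α) (x : β), (∀ a ∈ m, a ∈ l c) →
      codeSize (m.foldl (step c) x) ≤ codeSize x + m.length * D.eval (codeSize c) := by
    intro m
    induction m with
    | nil => simp
    | cons a m ih =>
      intro x hm
      have h₁ := ih (step c x a) fun b hb => hm b (List.mem_cons_of_mem _ hb)
      have h₂ := hD c x a (hm a List.mem_cons_self)
      rw [List.foldl_cons, List.length_cons, Nat.succ_mul]
      omega
  have h₁ := key l₁ (init c) fun a ha => h.subset ha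
  have h₂ := hI c
  have h₃ := Nat.mul_le_mul_right (D.eval (codeSize c))
    ((h.length_le.trans (length_le_codeSize (l c))).trans (hL c))
  simp only [Polynomial.eval_add, Polynomial.eval_mul]
  omega

/-! ### Lists, numbers and truth values -/

theorem cons {f : γ → α} {l : γ → List α} (hf : PolyTime f) (hl : PolyTime l) :
    PolyTime fun c => f c :: l c :=
  of_toData_eq (g := fun x : α × List α => x.1 :: x.2) (hf.pair hl) fun _ => rfl

theorem reverse {l : γ → List α} (hl : PolyTime l) : PolyTime fun c => (l c).reverse := by
  have h := foldl_of_le (step := fun (_ : γ) (x : List α) a => a :: x) hl (const [])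
    (id.snd.snd.cons id.snd.fst) (by
      obtain ⟨D, hD⟩ := hl.size_le
      refine ⟨D + 1, fun c x a ha => ?_⟩
      have := (codeSize_le_of_mem ha).trans (hD c)
      simp only [codeSize_cons, Polynomial.eval_add, Polynomial.eval_one]
      omega)
  simpa using h

theorem append {l m : γ → List α} (hl : PolyTime l) (hm : PolyTime m) :
    PolyTime fun c => l c ++ m c := by
  have h := foldl_of_le (step := fun (_ : γ) (x : List α) a => a :: x) hl.reverse hm
    (id.snd.snd.cons id.snd.fst) (by
      obtain ⟨D, hD⟩ := hl.size_le
      refine ⟨D + 1, fun c x a ha => ?_⟩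
      have := (codeSize_le_of_mem (List.mem_reverse.1 ha)).trans (hD c)
      simp only [codeSize_cons, Polynomial.eval_add, Polynomial.eval_one]
      omega)
  simpa using h

theorem flatMap {l : γ → List α} {f : γ → α → List β} (hl : PolyTime l)
    (hf : PolyTime fun x : γ × α => f x.1 x.2) : PolyTime fun c => (l c).flatMap (f c) := by
  have h := foldl_of_le (step := fun (c : γ) (x : List β) a => x ++ f c a) hl (const [])
    (id.snd.fst.append (hf.comp (id.fst.pair id.snd.snd))) (by
      obtain ⟨D, hD⟩ := hl.size_le_of_mem hf
      refine ⟨D, fun c x a ha => ?_⟩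
      have := hD c a ha
      have := codeSize_append x (f c a)
      omega)
  simpa only [List.flatMap_eq_foldl] using h

theorem map {l : γ → List α} {f : γ → α → β} (hl : PolyTime l)
    (hf : PolyTime fun x : γ × α => f x.1 x.2) : PolyTime fun c => (l c).map (f c) := by
  simpa only [List.map_eq_flatMap] using flatMap (f := fun c a => [f c a]) hl (hf.cons (const []))

theorem filter {l : γ → List α} {f : γ → α → Bool} (hl : PolyTime l)
    (hf : PolyTime fun x : γ × α => f x.1 x.2) : PolyTime fun c => (l c).filter (f c) := by
  have h := flatMap (f := fun c a => if f c a then [a] else []) hl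
    (ite hf (id.snd.cons (const [])) (const []))
  convert h using 2 with c
  induction l c with
  | nil => rfl
  | cons a m ih => rw [List.filter_cons, List.flatMap_cons, ih]; split <;> simp

theorem and {f g : γ → Bool} (hf : PolyTime f) (hg : PolyTime g) :
    PolyTime fun c => f c && g c := by
  convert ite hf hg (const false) using 2 with c
  cases f c <;> simp

theorem or {f g : γ → Bool} (hf : PolyTime f) (hg : PolyTime g) :
    PolyTime fun c => f c || g c := by
  convert ite hf (const true) hg using 2 with c
  cases f c <;> simp

theorem not {f : γ → Bool} (hf : PolyTime f) : PolyTime fun c => !f c := by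
  convert ite hf (const false) (const true) using 2 with c
  cases f c <;> simp

theorem any {l : γ → List α} {f : γ → α → Bool} (hl : PolyTime l)
    (hf : PolyTime fun x : γ × α => f x.1 x.2) : PolyTime fun c => (l c).any (f c) := by
  have h := foldl_of_le (step := fun (c : γ) (x : Bool) a => x || f c a) hl (const false)
    (id.snd.fst.or (hf.comp (id.fst.pair id.snd.snd))) ⟨3, fun c x a _ => by
      have := codeSize_bool (x || f c a)
      simp only [Polynomial.eval_ofNat]
      omega⟩
  convert h using 2 with c
  have key : ∀ (m : List α) (x : Bool), m.foldl (fun x a => x || f c a) x = (x || m.any (f c)) := by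
    intro m
    induction m with
    | nil => simp
    | cons a m ih => intro x; rw [List.foldl_cons, ih, List.any_cons, Bool.or_assoc]
  rw [key, Bool.false_or]

theorem all {l : γ → List α} {f : γ → α → Bool} (hl : PolyTime l)
    (hf : PolyTime fun x : γ × α => f x.1 x.2) : PolyTime fun c => (l c).all (f c) := by
  simpa [List.not_any_eq_all_not] using (any (f := fun c a => !f c a) hl hf.not).not

theorem zip {l : γ → List α} {m : γ → List β} (hl : PolyTime l) (hm : PolyTime m) :
    PolyTime fun c => (l c).zip (m c) := by
  let step : List (α × β) × List β → α → List (α × β) × List β := fun x a =>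
    match x.2 with
    | [] => x
    | b :: t => ((a, b) :: x.1, t)
  have hs : PolyTime fun x : γ × (List (α × β) × List β) × α => step x.2.1 x.2.2 :=
    listCases (y := fun s b t => ((s.2.2, b) :: s.2.1.1, t)) id.snd.fst.snd id.snd.fst
      (((id.fst.snd.snd.pair id.snd.fst).cons id.fst.snd.fst.fst).pair id.snd.snd)
  have h := foldl_of_le (step := fun _ => step) hl ((const []).pair hm) hs (by
    obtain ⟨D, hD⟩ := hl.size_le
    refine ⟨D + 2, fun c x a ha => ?_⟩
    have := (codeSize_le_of_mem ha).trans (hD c)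
    obtain ⟨x, _ | ⟨b, t⟩⟩ := x <;>
    · simp only [step, codeSize_cons, codeSize_pair, Polynomial.eval_add, Polynomial.eval_ofNat]
      omega)
  have key : ∀ (l : List α) (m : List β) (x : List (α × β)),
      (l.foldl step (x, m)).1.reverse = x.reverse ++ l.zip m := by
    intro l
    induction l with
    | nil => simp
    | cons a l ih =>
      rintro (_ | ⟨b, m⟩) x
      · have := ih [] x
        simpa [step] using this
      · simp [step, ih]
  convert h.fst.reverse using 2 with c
  simp [key]

theorem length {l : γ → List α} (hl : PolyTime l) : PolyTime fun c => (l c).length := by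
  have h := of_toData_eq (g := fun l : List Unit => l.length)
    (hl.map (f := fun _ _ => ()) (const ())) fun l => by
      induction l with
      | nil => rfl
      | cons a l ih => exact congrArg (Data.cons .nil) ih
  simpa using h

theorem replicate {n : γ → ℕ} (hn : PolyTime n) : PolyTime fun c => List.replicate (n c) () :=
  of_toData_eq (g := fun n => List.replicate n ()) hn fun n => by
    induction n with
    | zero => rfl
    | succ n ih => exact congrArg (Data.cons .nil) ih

theorem add {m n : γ → ℕ} (hm : PolyTime m) (hn : PolyTime n) : PolyTime fun c => m c + n c := by
  simpa using (hm.replicate.append hn.replicate).length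

theorem mul {m n : γ → ℕ} (hm : PolyTime m) (hn : PolyTime n) : PolyTime fun c => m c * n c := by
  simpa using (hm.replicate.flatMap (f := fun c _ => List.replicate (n c) ())
    (hn.replicate.comp id.fst)).length

theorem range {n : γ → ℕ} (hn : PolyTime n) : PolyTime fun c => List.range (n c) := by
  have hr : ∀ m : ℕ, (List.replicate m ()).foldl (fun x _ => x ++ [x.length]) [] =
      List.range m := by
    intro m
    induction m with
    | zero => rfl
    | succ m ih => rw [List.replicate_succ', List.foldl_append, ih]; simp [List.range_succ]
  have hb : ∀ m : ℕ, codeSize (List.range m) ≤ 1 + m * (2 * m + 2) := by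
    intro m
    induction m with
    | zero => simp
    | succ m ih =>
      have := codeSize_append (List.range m) [m]
      rw [List.range_succ]
      simp only [codeSize_cons, codeSize_nil, codeSize_nat] at this
      nlinarith
  have h := foldl (step := fun (_ : γ) (x : List ℕ) (_ : Unit) => x ++ [x.length])
    hn.replicate (const []) (id.snd.fst.append (id.snd.fst.length.cons (const []))) (by
      obtain ⟨D, hD⟩ := hn.size_le
      refine ⟨1 + D * (2 * D + 2), fun c l₁ h => ?_⟩
      have hl : l₁ = List.replicate l₁.length () := List.eq_replicate_iff.2 ⟨rfl, fun _ _ => rfl⟩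
      have h₁ : l₁.length ≤ D.eval (codeSize c) := by
        have := h.length_le
        have h₂ := hD c
        rw [List.length_replicate] at this
        rw [codeSize_nat] at h₂
        omega
      rw [hl, hr]
      refine (hb _).trans ?_
      simp only [Polynomial.eval_add, Polynomial.eval_mul, Polynomial.eval_ofNat,
        Polynomial.eval_one]
      gcongr)
  simpa only [hr] using h

theorem beq {m n : γ → ℕ} (hm : PolyTime m) (hn : PolyTime n) : PolyTime fun c => m c == n c := by
  have hpred : PolyTime fun n : ℕ => n - 1 := by
    refine ⟨.snd, .X + 1, fun n => ?_⟩
    cases n with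
    | zero => exact ⟨_, .snd_nil, by simp [Data.size]⟩
    | succ n => exact ⟨_, .snd_cons _ _, by simp [codeSize, toData, Data.ofNat]⟩
  have hle : ∀ {m n : γ → ℕ}, PolyTime m → PolyTime n → PolyTime fun c => decide (m c ≤ n c) := by
    intro m n hm hn
    have hs : PolyTime fun c => m c - n c := by
      have h := foldl_of_le (step := fun (_ : γ) (x : ℕ) (_ : Unit) => x - 1) hn.replicate hm
        (hpred.comp id.snd.fst) ⟨0, fun c x _ _ => by
          simp only [codeSize_nat, Polynomial.eval_zero]; omega⟩
      have hr : ∀ k a : ℕ, (List.replicate k ()).foldl (fun x _ => x - 1) a = a - k := by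
        intro k
        induction k with
        | zero => simp
        | succ k ih => intro a; rw [List.replicate_succ, List.foldl_cons, ih]; omega
      simpa only [hr] using h
    convert listCases (y := fun _ _ _ => false) hs.replicate (const true) (const false)
      using 2 with c
    cases h : m c - n c with
    | zero => simpa using Nat.sub_eq_zero_iff_le.1 h
    | succ k => simp [List.replicate_succ]; omega
  convert (hle hm hn).and (hle hn hm) using 2 with c
  rw [Bool.eq_iff_iff, beq_iff_eq, Bool.and_eq_true, decide_eq_true_iff, decide_eq_true_iff,
    le_antisymm_iff]

theorem elem {a : γ → ℕ} {l : γ → List ℕ} (ha : PolyTime a) (hl : PolyTime l) :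
    PolyTime fun c => (l c).contains (a c) := by
  simpa only [List.contains_eq_any_beq] using
    hl.any (f := fun c b => a c == b) ((ha.comp id.fst).beq id.snd)

theorem elem_pair {a : γ → ℕ × ℕ} {l : γ → List (ℕ × ℕ)} (ha : PolyTime a) (hl : PolyTime l) :
    PolyTime fun c => (l c).contains (a c) := by
  convert hl.any (f := fun c b => (a c).1 == b.1 && (a c).2 == b.2)
    (((ha.comp id.fst).fst.beq id.snd.fst).and ((ha.comp id.fst).snd.beq id.snd.snd)) using 2 with c
  rw [List.contains_eq_any_beq]
  rfl

end PolyTime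

end

/-! ### The algorithm on untyped descriptions -/

/-- An untyped fact: the index of a relation symbol and a list of elements. -/
abbrev RawFact : Type := ℕ × List ℕ

/-- An untyped structure: the size of the domain, the facts, and the distinguished elements. -/
abbrev RawStr : Type := ℕ × List RawFact × List ℕ

namespace RawFact

/-- The facts `f` and `g` have the same relation symbol, and corresponding elements are related
by `M`. -/
def related (M : List (ℕ × ℕ)) (f g : RawFact) : Bool :=
  f.1 == g.1 && (f.2.zip g.2).all fun x => M.contains x

end RawFact

open RawFact

/-- Arc consistency of the pair `x = (a, c)` relative to `M`: each fact in `F` that contains `a` is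
related by `M` to a fact in `G` that has `c` in the same position. -/
def arcConsistent (F G : List RawFact) (M : List (ℕ × ℕ)) (x : ℕ × ℕ) : Bool :=
  F.all fun f => !(f.2.contains x.1) || G.any fun g => related M f g && (f.2.zip g.2).contains x

/-- One round of arc consistency. Pairs with a distinguished first component are never removed. -/
def arcStep (pts : List ℕ) (F G : List RawFact) (M : List (ℕ × ℕ)) : List (ℕ × ℕ) :=
  M.filter fun x => pts.contains x.1 || arcConsistent F G M x

/-- All pairs of elements of `{0, …, n - 1}` in which a distinguished first component is paired
with itself only. -/
def arcInit (n : ℕ) (pts : List ℕ) : List (ℕ × ℕ) :=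
  (List.range n).flatMap fun a =>
    ((List.range n).filter fun c => !(pts.contains a) || a == c).map fun c => (a, c)

/-- The result of the arc consistency procedure. As many rounds are run as there are pairs at the
beginning, so a further round would change nothing. -/
def arcFix (n : ℕ) (pts : List ℕ) (F G : List RawFact) : List (ℕ × ℕ) :=
  (arcInit n pts).foldl (fun M _ => arcStep pts F G M) (arcInit n pts)

/-- The arc consistency test for a homomorphism from the structure with the facts `F` to the one
with the facts `G`, on the same domain and with the same distinguished elements. -/
def homTest (n : ℕ) (pts : List ℕ) (F G : List RawFact) : Bool :=
  F.all fun f => G.any fun g => related (arcFix n pts F G) f g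

/-- A step of the greedy minimization of a list under the test `t`: from the pair of the list of
members that are kept and the list of members that are still to be examined, move the first
member of the second list to the first list, or drop it if the test permits. -/
def greedyStep {α : Type} (t : List α → Bool) (s : List α × List α) : List α × List α :=
  match s.2 with
  | [] => s
  | a :: l => if t (s.1 ++ l) then (s.1, l) else (a :: s.1, l)

/-- A sublist (up to order) that is minimal among those that pass the test `t`. -/
def greedy {α : Type} (t : List α → Bool) (l : List α) : List α :=
  (l.foldl (fun s _ => greedyStep t s) ([], l)).1

/-- A minimal list of facts that still admits a homomorphism from the given structure. -/
def rawCore (n : ℕ) (pts : List ℕ) (F : List RawFact) : List RawFact :=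
  greedy (homTest n pts F) F

/-- All ways to attach to each of the first `K` members `a` of a list a label from `labs a`. -/
def labelings (labs : ℕ → List ℕ) : ℕ → List ℕ → List (List (ℕ × ℕ))
  | 0, _ => [[]]
  | K + 1, l =>
    match l with
    | [] => [[]]
    | a :: l => (labelings labs K l).flatMap fun r => (labs a).map fun j => (a, j) :: r

/-- The number that stands for the pair of an element and a label smaller than `w`. -/
def pairCode (w : ℕ) (x : ℕ × ℕ) : ℕ := x.1 * w + x.2

/-- The facts that arise from the enumerated facts in `E` by attaching labels to their elements,
in all ways that are admissible according to `ok`. -/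
def relabel (K w : ℕ) (labs : ℕ → List ℕ) (ok : ℕ → List (ℕ × ℕ) → Bool)
    (E : List (ℕ × RawFact)) : List RawFact :=
  E.flatMap fun e => ((labelings labs K e.2.2).filter fun l => ok e.1 l).map fun l =>
    (e.2.1, l.map (pairCode w))

/-- The list of facts together with their positions. -/
def enumerate (F : List RawFact) : List (ℕ × RawFact) := (List.range F.length).zip F

/-- The labels of the element `a`: the positions of the facts that contain it, and the number of
all facts as an additional label. -/
def factLabels (F : List RawFact) (a : ℕ) : List ℕ :=
  F.length :: ((enumerate F).filter fun e => e.2.2.contains a).map fun e => e.1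

/-- The condition on the labels in the copies of the fact with position `j` in the member of the
frontier that belongs to the fact with position `j₀`. -/
def okLabels (pts : List ℕ) (m j₀ j : ℕ) (l : List (ℕ × ℕ)) : Bool :=
  (l.any fun x => pts.contains x.1 && !(x.2 == m)) ||
    ((!(j == j₀) && l.all fun x => pts.contains x.1 || x.2 == m) ||
      ((l.all fun x => pts.contains x.1 || !(x.2 == m)) &&
        l.any fun x => !(pts.contains x.1) && !(x.2 == j)))

/-- The members of the frontier in which equal distinguished elements are split. -/
def splitPart (K k n : ℕ) (F : List RawFact) (pts : List ℕ) : List RawStr :=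
  ((labelings (fun _ => [0, 1]) k pts).filter fun l =>
      l.any fun x => l.any fun y => x.1 == y.1 && !(x.2 == y.2)).map fun l =>
    (n * 2, relabel K 2 (fun _ => [0, 1]) (fun _ _ => true) (enumerate F), l.map (pairCode 2))

/-- The members of the frontier that belong to the facts. -/
def obstructedPart (K n : ℕ) (F : List RawFact) (pts : List ℕ) : List RawStr :=
  (List.range F.length).map fun j₀ =>
    (n * (F.length + 1),
      relabel K (F.length + 1) (factLabels F) (okLabels pts F.length j₀) (enumerate F),
      pts.map fun a => pairCode (F.length + 1) (a, F.length))

/-- The algorithm, for facts with at most `K` and structures with `k` distinguished elements. -/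
def rawFrontier (K k : ℕ) (P : RawStr) : List RawStr :=
  splitPart K k P.1 (rawCore P.1 P.2.2 P.2.1) P.2.2 ++
    obstructedPart K P.1 (rawCore P.1 P.2.2 P.2.1) P.2.2

/-! ### The algorithm runs in polynomial time -/

namespace PolyTime

variable {α γ : Type} [ToData α] [ToData γ]

theorem related {M : γ → List (ℕ × ℕ)} {f g : γ → RawFact} (hM : PolyTime M) (hf : PolyTime f)
    (hg : PolyTime g) : PolyTime fun c => RawFact.related (M c) (f c) (g c) :=
  (hf.fst.beq hg.fst).and ((hf.snd.zip hg.snd).all (id.snd.elem_pair (hM.comp id.fst)))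

theorem arcConsistent {F G : γ → List RawFact} {M : γ → List (ℕ × ℕ)} {x : γ → ℕ × ℕ}
    (hF : PolyTime F) (hG : PolyTime G) (hM : PolyTime M) (hx : PolyTime x) :
    PolyTime fun c => arcConsistent (F c) (G c) (M c) (x c) := by
  have hG' : PolyTime fun s : γ × RawFact => (G s.1).any fun g =>
      RawFact.related (M s.1) s.2 g && (s.2.2.zip g.2).contains (x s.1) :=
    (hG.comp id.fst).any (f := fun (s : γ × RawFact) (g : RawFact) =>
        RawFact.related (M s.1) s.2 g && (s.2.2.zip g.2).contains (x s.1))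
      (((hM.comp id.fst.fst).related id.fst.snd id.snd).and
        ((hx.comp id.fst.fst).elem_pair (id.fst.snd.snd.zip id.snd.snd)))
  exact hF.all (((hx.comp id.fst).fst.elem id.snd.snd).not.or hG')

theorem arcStep {pts : γ → List ℕ} {F G : γ → List RawFact} {M : γ → List (ℕ × ℕ)}
    (hp : PolyTime pts) (hF : PolyTime F) (hG : PolyTime G) (hM : PolyTime M) :
    PolyTime fun c => arcStep (pts c) (F c) (G c) (M c) :=
  hM.filter ((id.snd.fst.elem (hp.comp id.fst)).or
    ((hF.comp id.fst).arcConsistent (hG.comp id.fst) (hM.comp id.fst) id.snd))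

theorem arcInit {n : γ → ℕ} {pts : γ → List ℕ} (hn : PolyTime n) (hp : PolyTime pts) :
    PolyTime fun c => arcInit (n c) (pts c) :=
  hn.range.flatMap (((hn.comp id.fst).range.filter
      (f := fun s c => !((pts s.1).contains s.2) || s.2 == c)
      ((id.fst.snd.elem (hp.comp id.fst.fst)).not.or (id.fst.snd.beq id.snd))).map
    (f := fun s c => (s.2, c)) (id.fst.snd.pair id.snd))

theorem arcFix {n : γ → ℕ} {pts : γ → List ℕ} {F G : γ → List RawFact} (hn : PolyTime n)
    (hp : PolyTime pts) (hF : PolyTime F) (hG : PolyTime G) :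
    PolyTime fun c => arcFix (n c) (pts c) (F c) (G c) :=
  foldl_of_le (step := fun c M _ => _root_.arcStep (pts c) (F c) (G c) M) (hn.arcInit hp)
    (hn.arcInit hp)
    ((hp.comp id.fst).arcStep (hF.comp id.fst) (hG.comp id.fst) id.snd.fst)
    ⟨0, fun _ _ _ _ => by
      simpa [_root_.arcStep] using codeSize_le_of_sublist List.filter_sublist⟩

theorem homTest {n : γ → ℕ} {pts : γ → List ℕ} {F G : γ → List RawFact} (hn : PolyTime n)
    (hp : PolyTime pts) (hF : PolyTime F) (hG : PolyTime G) :
    PolyTime fun c => homTest (n c) (pts c) (F c) (G c) :=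
  hF.all ((hG.comp id.fst).any
    (f := fun s g => RawFact.related (_root_.arcFix (n s.1) (pts s.1) (F s.1) (G s.1)) s.2 g)
    (((hn.comp id.fst.fst).arcFix (hp.comp id.fst.fst) (hF.comp id.fst.fst)
      (hG.comp id.fst.fst)).related id.fst.snd id.snd))

theorem greedy {t : γ → List α → Bool} {l : γ → List α}
    (ht : PolyTime fun x : γ × List α => t x.1 x.2) (hl : PolyTime l) :
    PolyTime fun c => greedy (t c) (l c) := by
  refine (foldl_of_le (step := fun c s _ => greedyStep (t c) s) hl ((const []).pair hl) ?_
    ⟨0, fun c s _ _ => ?_⟩).fst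
  · exact listCases (y := fun (x : γ × (List α × List α) × α) a l =>
        if t x.1 (x.2.1.1 ++ l) then (x.2.1.1, l) else (a :: x.2.1.1, l)) id.snd.fst.snd id.snd.fst
      (ite (ht.comp (id.fst.fst.pair (id.fst.snd.fst.fst.append id.snd.snd)))
        (id.fst.snd.fst.fst.pair id.snd.snd)
        ((id.snd.fst.cons id.fst.snd.fst.fst).pair id.snd.snd))
  · obtain ⟨d, _ | ⟨a, l⟩⟩ := s
    · simp [greedyStep]
    · simp only [greedyStep]
      split <;> simp only [codeSize_pair, codeSize_cons] <;> omega

theorem rawCore {n : γ → ℕ} {pts : γ → List ℕ} {F : γ → List RawFact} (hn : PolyTime n)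
    (hp : PolyTime pts) (hF : PolyTime F) : PolyTime fun c => rawCore (n c) (pts c) (F c) :=
  greedy ((hn.comp id.fst).homTest (hp.comp id.fst) (hF.comp id.fst) id.snd) hF

/-- For a fixed bound on the length of the list, all labelings can be listed in polynomial time:
the recursion is unfolded into the program. -/
theorem labelings {labs : γ → ℕ → List ℕ} {l : γ → List ℕ}
    (hlabs : PolyTime fun x : γ × ℕ => labs x.1 x.2) (K : ℕ) (hl : PolyTime l) :
    PolyTime fun c => labelings (labs c) K (l c) := by
  induction K generalizing γ with
  | zero => exact const [[]]
  | succ K ih =>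
    convert listCases (y := fun c a l => (_root_.labelings (labs c) K l).flatMap fun r =>
      (labs c a).map fun j => (a, j) :: r) hl (const [[]]) ?_ using 2 with c
    · cases l c <;> rfl
    exact flatMap (f := fun (x : γ × ℕ × List ℕ) r => (labs x.1 x.2.1).map fun j => (x.2.1, j) :: r)
      (ih (labs := fun (x : γ × ℕ × List ℕ) => labs x.1) (hlabs.comp (id.fst.fst.pair id.snd))
        id.snd.snd)
      ((hlabs.comp (id.fst.fst.pair id.fst.snd.fst)).map
        (f := fun (x : (γ × ℕ × List ℕ) × List (ℕ × ℕ)) j => (x.1.2.1, j) :: x.2)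
        ((id.fst.fst.snd.fst.pair id.snd).cons id.fst.snd))

theorem pairCode {w : γ → ℕ} {x : γ → ℕ × ℕ} (hw : PolyTime w) (hx : PolyTime x) :
    PolyTime fun c => pairCode (w c) (x c) := (hx.fst.mul hw).add hx.snd

theorem relabel {w : γ → ℕ} {labs : γ → ℕ → List ℕ} {ok : γ → ℕ → List (ℕ × ℕ) → Bool}
    {E : γ → List (ℕ × RawFact)} (K : ℕ) (hw : PolyTime w)
    (hlabs : PolyTime fun x : γ × ℕ => labs x.1 x.2)
    (hok : PolyTime fun x : γ × ℕ × List (ℕ × ℕ) => ok x.1 x.2.1 x.2.2) (hE : PolyTime E) :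
    PolyTime fun c => relabel K (w c) (labs c) (ok c) (E c) :=
  hE.flatMap (((labelings (labs := fun x : γ × ℕ × RawFact => labs x.1)
      (hlabs.comp (id.fst.fst.pair id.snd)) K id.snd.snd.snd).filter
      (f := fun x l => ok x.1 x.2.1 l)
      (hok.comp (id.fst.fst.pair (id.fst.snd.fst.pair id.snd)))).map
    (f := fun x l => (x.2.2.1, l.map (_root_.pairCode (w x.1))))
    (id.fst.snd.snd.fst.pair (id.snd.map ((hw.comp id.fst.fst.fst).pairCode id.snd))))

theorem enumerate {F : γ → List RawFact} (hF : PolyTime F) : PolyTime fun c => enumerate (F c) :=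
  hF.length.range.zip hF

theorem factLabels {F : γ → List RawFact} {a : γ → ℕ} (hF : PolyTime F) (ha : PolyTime a) :
    PolyTime fun c => factLabels (F c) (a c) :=
  hF.length.cons ((hF.enumerate.filter ((ha.comp id.fst).elem id.snd.snd.snd)).map
    (f := fun _ e => e.1) id.snd.fst)

theorem okLabels {pts : γ → List ℕ} {m j₀ j : γ → ℕ} {l : γ → List (ℕ × ℕ)} (hp : PolyTime pts)
    (hm : PolyTime m) (hj₀ : PolyTime j₀) (hj : PolyTime j) (hl : PolyTime l) :
    PolyTime fun c => okLabels (pts c) (m c) (j₀ c) (j c) (l c) := by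
  have hpt := id.snd.fst.elem (hp.comp (id (α := γ × ℕ × ℕ)).fst)
  have hlab := id.snd.snd.beq (hm.comp (id (α := γ × ℕ × ℕ)).fst)
  exact (hl.any (hpt.and hlab.not)).or (((hj.beq hj₀).not.and (hl.all (hpt.or hlab))).or
    ((hl.all (hpt.or hlab.not)).and
      (hl.any (hpt.not.and (id.snd.snd.beq (hj.comp id.fst)).not))))

theorem splitPart {n : γ → ℕ} {pts : γ → List ℕ} {F : γ → List RawFact} (K k : ℕ)
    (hn : PolyTime n) (hF : PolyTime F) (hp : PolyTime pts) :
    PolyTime fun c => splitPart K k (n c) (F c) (pts c) := by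
  have hne : PolyTime fun x : ((γ × List (ℕ × ℕ)) × ℕ × ℕ) × ℕ × ℕ =>
      x.1.2.1 == x.2.1 && !(x.1.2.2 == x.2.2) :=
    (id.fst.snd.fst.beq id.snd.fst).and (id.fst.snd.snd.beq id.snd.snd).not
  have hfilter : PolyTime fun x : γ × List (ℕ × ℕ) =>
      x.2.any fun x' => x.2.any fun y => x'.1 == y.1 && !(x'.2 == y.2) :=
    id.snd.any (id.fst.snd.any (f := fun (s : (γ × List (ℕ × ℕ)) × ℕ × ℕ) (y : ℕ × ℕ) =>
      s.2.1 == y.1 && !(s.2.2 == y.2)) hne)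
  have hfacts : PolyTime fun x : γ × List (ℕ × ℕ) => _root_.relabel K 2 (fun _ => [0, 1])
      (fun _ _ => true) (_root_.enumerate (F x.1)) :=
    relabel (labs := fun _ _ => [0, 1]) (ok := fun _ _ _ => true) K (const 2) (const _) (const _)
      (hF.comp id.fst).enumerate
  have hpts : PolyTime fun x : γ × List (ℕ × ℕ) => x.2.map (_root_.pairCode 2) :=
    id.snd.map (f := fun _ x => _root_.pairCode 2 x) ((const 2).pairCode id.snd)
  exact ((labelings (labs := fun _ _ => [0, 1]) (const _) k hp).filter hfilter).map
    (((hn.comp id.fst).mul (const 2)).pair (hfacts.pair hpts))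

theorem obstructedPart {n : γ → ℕ} {pts : γ → List ℕ} {F : γ → List RawFact} (K : ℕ)
    (hn : PolyTime n) (hF : PolyTime F) (hp : PolyTime pts) :
    PolyTime fun c => obstructedPart K (n c) (F c) (pts c) := by
  have hw : PolyTime fun x : γ × ℕ => (F x.1).length + 1 := (hF.comp id.fst).length.add (const 1)
  exact hF.length.range.map (((hn.comp id.fst).mul hw).pair
    ((relabel (labs := fun x => _root_.factLabels (F x.1))
        (ok := fun x => _root_.okLabels (pts x.1) (F x.1).length x.2) K hw
        ((hF.comp id.fst.fst).factLabels id.snd)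
        ((hp.comp id.fst.fst).okLabels (hF.comp id.fst.fst).length id.fst.snd id.snd.fst
          id.snd.snd)
        (hF.comp id.fst).enumerate).pair
      ((hp.comp id.fst).map (f := fun x a => _root_.pairCode ((F x.1).length + 1)
        (a, (F x.1).length)) ((hw.comp id.fst).pairCode
          (id.snd.pair (hF.comp id.fst.fst).length)))))

theorem rawFrontier (K k : ℕ) : PolyTime (rawFrontier K k) :=
  have hcore := id.fst.rawCore id.snd.snd (id (α := RawStr)).snd.fst
  (splitPart K k id.fst hcore id.snd.snd).append (obstructedPart K id.fst hcore id.snd.snd)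

end PolyTime

/-! ### Cycles in finite graphs -/

namespace SimpleGraph

/-- An infinite walk without backtracking in a finite graph runs through a cycle. -/
theorem exists_isCycle_of_nonbacktracking {V : Type*} [Finite V] {G : SimpleGraph V} (u : ℕ → V)
    (hadj : ∀ i, G.Adj (u i) (u (i + 1))) (hne : ∀ i, u i ≠ u (i + 2)) :
    ∃ (v : V) (w : G.Walk v v), w.IsCycle ∧ ∀ x ∈ w.support, x ∈ Set.range u := by
  have hwalk : ∀ n s, ∃ w : G.Walk (u s) (u (s + n)),
      w.support = (List.range (n + 1)).map (fun t => u (s + t)) ∧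
      w.edges = (List.range n).map (fun t => s(u (s + t), u (s + t + 1))) := by
    intro n
    induction n with
    | zero => exact fun s => ⟨.nil, by simp, by simp⟩
    | succ n ih =>
      intro s
      obtain ⟨w, hs, he⟩ := ih s
      refine ⟨w.concat (hadj (s + n)), ?_, ?_⟩
      · rw [Walk.support_concat, hs, List.range_succ (n := n + 1)]
        simp
      · rw [Walk.edges_concat, he, List.range_succ]
        simp [add_assoc]
  -- the first repetition
  obtain ⟨j, ⟨i, hij, hu⟩, hmin⟩ : ∃ j, (∃ i < j, u i = u j) ∧
      ∀ j' < j, ¬ ∃ i < j', u i = u j' := by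
    obtain ⟨a, b, hab, h⟩ := Finite.exists_ne_map_eq_of_infinite u
    classical
    have hex : ∃ j, ∃ i < j, u i = u j := by
      rcases lt_or_gt_of_ne hab with hlt | hlt
      · exact ⟨b, a, hlt, h⟩
      · exact ⟨a, b, hlt, h.symm⟩
    exact ⟨Nat.find hex, Nat.find_spec hex, fun _ h => Nat.find_min hex h⟩
  have hinj : ∀ s < j, ∀ t < j, u s = u t → s = t := by
    intro s hs t ht hst
    rcases lt_trichotomy s t with h | h | h
    · exact absurd ⟨s, h, hst⟩ (hmin t ht)
    · exact h
    · exact absurd ⟨t, h, hst.symm⟩ (hmin s hs)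
  have hinj' : ∀ s, i < s → s ≤ j → ∀ t, i < t → t ≤ j → u s = u t → s = t := by
    intro s hs hsj t ht htj hst
    rcases hsj.lt_or_eq with hsj | rfl <;> rcases htj.lt_or_eq with htj | rfl
    · exact hinj s hsj t htj hst
    · exact absurd (hinj s hsj i hij (hst.trans hu.symm)) (by omega)
    · exact absurd (hinj t htj i hij (hst.symm.trans hu.symm)) (by omega)
    · rfl
  obtain ⟨n, rfl⟩ : ∃ n, j = i + 1 + n := ⟨j - (i + 1), by omega⟩
  obtain ⟨w, hs, he⟩ := hwalk n (i + 1)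
  refine ⟨u i, .cons (hadj i) (w.copy rfl hu.symm), ?_, ?_⟩
  · rw [Walk.cons_isCycle_iff]
    refine ⟨?_, ?_⟩
    · rw [Walk.isPath_copy, Walk.isPath_def, hs]
      refine List.Nodup.map_on (fun s hs t ht hst => ?_) List.nodup_range
      have := hinj' (i + 1 + s) (by omega) (by have := List.mem_range.1 hs; omega)
        (i + 1 + t) (by omega) (by have := List.mem_range.1 ht; omega) hst
      omega
    · rw [Walk.edges_copy, he]
      simp only [List.mem_map, List.mem_range, not_exists, not_and]
      intro t ht h
      rcases Sym2.eq_iff.1 h with ⟨h₁, h₂⟩ | ⟨h₁, h₂⟩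
      · have := hinj (i + 1 + t) (by omega) i hij h₁
        omega
      · have h₃ := hinj (i + 1 + t) (by omega) (i + 1) (by
          rcases Nat.lt_or_ge (i + 1) (i + 1 + n) with h | h <;> omega) h₁
        have h₄ := hinj' (i + 1 + t + 1) (by omega) (by omega) (i + 1 + n) (by omega) le_rfl
          (h₂.trans hu)
        refine hne i (hu.trans (congrArg u ?_))
        omega
  · intro x hx
    rw [Walk.support_cons, Walk.support_copy, hs] at hx
    rcases List.mem_cons.1 hx with rfl | hx
    · exact ⟨i, rfl⟩
    · obtain ⟨t, _, rfl⟩ := List.mem_map.1 hx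
      exact ⟨_, rfl⟩

end SimpleGraph

namespace Str

variable {S : Schema} {k : ℕ}

/-! ### Homomorphisms -/

theorem MapsTo.refl (A : Str S k) : A.MapsTo A := ⟨fun a => a, fun _ => rfl, fun _ _ h => h⟩

theorem MapsTo.trans {A B C : Str S k} (h : A.MapsTo B) (h' : B.MapsTo C) : A.MapsTo C := by
  obtain ⟨f, hf, hf'⟩ := h
  obtain ⟨g, hg, hg'⟩ := h'
  exact ⟨fun a => g (f a), fun i => (congrArg g (hf i)).trans (hg i),
    fun r t ht => hg' r _ (hf' r t ht)⟩

/-- Frontiers are invariant under homomorphic equivalence, of the structure and of the members of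
the frontier. -/
theorem IsFrontier.congr {𝒞 F F' : Set (Str S k)} {A A' : Str S k} (h : IsFrontier 𝒞 F A)
    (hAA' : A.MapsTo A') (hA'A : A'.MapsTo A)
    (hF : ∀ B ∈ F, ∃ B' ∈ F', B.MapsTo B') (hF' : ∀ B' ∈ F', ∃ B ∈ F, B.MapsTo B' ∧ B'.MapsTo B) :
    IsFrontier 𝒞 F' A' := by
  refine ⟨fun B' hB' => ?_, fun B' hB' hn => ?_, fun C hC hCA hAC => ?_⟩
  · obtain ⟨B, hB, _, h'⟩ := hF' B' hB'
    exact (h'.trans (h.1 B hB)).trans hAA'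
  · obtain ⟨B, hB, _, h'⟩ := hF' B' hB'
    exact h.2.1 B hB ((hAA'.trans hn).trans h')
  · obtain ⟨B, hB, hCB⟩ := h.2.2 C hC (hCA.trans hA'A) fun h' => hAC (hA'A.trans h')
    obtain ⟨B', hB', hBB'⟩ := hF B hB
    exact ⟨B', hB', hCB.trans hBB'⟩

/-! ### Consequences of acyclicity -/

/-- The element `a` is distinguished. -/
def IsPt (A : Str S k) (a : A.dom) : Prop := ∃ i, A.pt i = a

/-- The form in which acyclicity is used: elements that are not distinguished occur at most once in
a fact, and no infinite sequence of facts and connecting elements that are not distinguished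
proceeds without turning back. This property is inherited by substructures. -/
structure IsForest (A : Str S k) : Prop where
  isPt_of_eq : ∀ (f : A.Fact) p q, p ≠ q → f.1.2 p = f.1.2 q → A.IsPt (f.1.2 p)
  no_walk : ∀ (f : ℕ → A.Fact) (a : ℕ → A.dom), (∀ i, ¬ A.IsPt (a i)) →
    (∀ i, A.Occurs (a i) (f i)) → (∀ i, A.Occurs (a i) (f (i + 1))) →
    (∀ i, f i ≠ f (i + 1)) → ¬ ∀ i, a i ≠ a (i + 1)

instance (A : Str S k) : Finite A.dom := A.finite_dom

instance (A : Str S k) : Nonempty A.dom := A.nonempty_dom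

instance (A : Str S k) : Finite A.Fact :=
  inferInstanceAs (Finite {f : S.Atom A.dom // f.2 ∈ A.rel f.1})

theorem incidenceGraph_adj {A : Str S k} {a : A.dom} {f : A.Fact} (h : A.Occurs a f) :
    A.incidenceGraph.Adj (.inl a) (.inr f) := by
  simp only [incidenceGraph, SimpleGraph.fromRel_adj]
  exact ⟨by simp, .inl ⟨a, f, rfl, rfl, h⟩⟩

theorem CAcyclic.isForest {A : Str S k} (h : A.CAcyclic) : A.IsForest := by
  refine ⟨h.1, fun f a hpt hocc hocc' hf ha => ?_⟩
  let u : ℕ → A.dom ⊕ A.Fact := fun i => if i % 2 = 0 then .inr (f (i / 2)) else .inl (a (i / 2))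
  have h0 : ∀ i, u (2 * i) = .inr (f i) := fun i => by simp [u]
  have h1 : ∀ i, u (2 * i + 1) = .inl (a i) := fun i => by
    simp only [u]
    rw [if_neg (by omega), show (2 * i + 1) / 2 = i by omega]
  obtain ⟨v, w, hw, hsupp⟩ := SimpleGraph.exists_isCycle_of_nonbacktracking
    (G := A.incidenceGraph) u (fun i => by
      obtain ⟨j, rfl | rfl⟩ := Nat.even_or_odd' i
      · rw [h0, h1]
        exact (incidenceGraph_adj (hocc j)).symm
      · rw [h1, show 2 * j + 1 + 1 = 2 * (j + 1) by ring, h0]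
        exact incidenceGraph_adj (hocc' j)) (fun i => by
      obtain ⟨j, rfl | rfl⟩ := Nat.even_or_odd' i
      · rw [show 2 * j + 2 = 2 * (j + 1) by ring, h0, h0]
        exact fun h => hf j (Sum.inr_injective h)
      · rw [show 2 * j + 1 + 2 = 2 * (j + 1) + 1 by ring, h1, h1]
        exact fun h => ha j (Sum.inl_injective h))
  obtain ⟨i, hi⟩ := h.2 v w hw
  obtain ⟨j, hj⟩ := hsupp _ hi
  obtain ⟨l, rfl | rfl⟩ := Nat.even_or_odd' j
  · rw [h0] at hj
    exact absurd hj (by simp)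
  · rw [h1] at hj
    exact hpt l ⟨i, (Sum.inl_injective hj).symm⟩

/-- In a nonempty set of facts of a forest, some fact shares at most one element that is not
distinguished with the other facts in the set. -/
theorem IsForest.exists_leaf {A : Str S k} (hA : A.IsForest) {Φ : Set A.Fact} (hΦ : Φ.Nonempty) :
    ∃ f ∈ Φ, ∀ a a', ¬ A.IsPt a → ¬ A.IsPt a' → A.Occurs a f → A.Occurs a' f →
      (∃ g ∈ Φ, g ≠ f ∧ A.Occurs a g) → (∃ g ∈ Φ, g ≠ f ∧ A.Occurs a' g) → a = a' := by
  by_contra! hcon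
  let T := {x : A.Fact × A.dom // x.1 ∈ Φ ∧ ¬ A.IsPt x.2 ∧ A.Occurs x.2 x.1 ∧
    ∃ g ∈ Φ, g ≠ x.1 ∧ A.Occurs x.2 g}
  have hnext : ∀ x : T, ∃ y : T, x.1.1 ≠ y.1.1 ∧ x.1.2 ≠ y.1.2 ∧ A.Occurs x.1.2 y.1.1 := by
    rintro ⟨⟨f, a⟩, hf, ha, haf, g, hg, hgf, hag⟩
    obtain ⟨b, b', hb, hb', hbg, hbg', h, h', hne⟩ := hcon g hg
    by_cases hab : a = b
    · exact ⟨⟨(g, b'), hg, hb', hbg', h'⟩, hgf.symm, hab ▸ hne, hag⟩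
    · exact ⟨⟨(g, b), hg, hb, hbg, h⟩, hgf.symm, hab, hag⟩
  choose next hnext using hnext
  obtain ⟨f, hf⟩ := hΦ
  obtain ⟨b, b', hb, hb', hbf, hbf', h, h', hne⟩ := hcon f hf
  let x : ℕ → T := fun i => next^[i] ⟨(f, b), hf, hb, hbf, h⟩
  have hx : ∀ i, x (i + 1) = next (x i) := fun i => Function.iterate_succ_apply' _ _ _
  refine hA.no_walk (fun i => (x i).1.1) (fun i => (x i).1.2) (fun i => (x i).2.2.1)
    (fun i => (x i).2.2.2.1) (fun i => ?_) (fun i => ?_) (fun i => ?_) <;>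
  · simp only [hx]
    first | exact (hnext (x i)).2.2 | exact (hnext (x i)).1 | exact (hnext (x i)).2.1

/-! ### Arc consistency -/

/-- `M` contains only pairs `(a, c)` that respect distinguished elements, and is closed under the
arc consistency condition for elements that are not distinguished. -/
structure IsArcConsistent (A C : Str S k) (M : A.dom → C.dom → Prop) : Prop where
  pt : ∀ i c, M (A.pt i) c → c = C.pt i
  arc : ∀ a c, M a c → ¬ A.IsPt a → ∀ (f : A.Fact) p, f.1.2 p = a →
    ∃ g ∈ C.rel f.1.1, g p = c ∧ ∀ q, M (f.1.2 q) (g q)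

/-- On forests, arc consistency is complete for the existence of homomorphisms. The homomorphism is
built by adding leaf facts one at a time. -/
theorem IsForest.mapsTo {A C : Str S k} (hA : A.IsForest)
    (hpt : ∀ i j, A.pt i = A.pt j → C.pt i = C.pt j) {M : A.dom → C.dom → Prop}
    (hM : IsArcConsistent A C M)
    (hfact : ∀ f : A.Fact, ∃ g ∈ C.rel f.1.1, ∀ q, M (f.1.2 q) (g q)) : A.MapsTo C := by
  classical
  have key : ∀ (n : ℕ) (Φ : Set A.Fact), Φ.ncard = n → ∃ h : A.dom → C.dom,
      (∀ i, h (A.pt i) = C.pt i) ∧ (∀ a, ¬ A.IsPt a → (∃ f ∈ Φ, A.Occurs a f) → M a (h a)) ∧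
      ∀ f ∈ Φ, (fun p => h (f.1.2 p)) ∈ C.rel f.1.1 := by
    intro n
    induction n with
    | zero =>
      intro Φ hΦ
      obtain rfl := (Set.ncard_eq_zero (Set.toFinite Φ)).1 hΦ
      refine ⟨fun a => if h : ∃ i, A.pt i = a then C.pt h.choose else C.nonempty_dom.some,
        fun i => ?_, fun a _ ⟨f, hf, _⟩ => hf.elim, fun f hf => hf.elim⟩
      have hex : ∃ j, A.pt j = A.pt i := ⟨i, rfl⟩
      simp only [dif_pos hex]
      exact hpt _ _ hex.choose_spec
    | succ n ih =>
      intro Φ hΦ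
      obtain ⟨f, hf, hleaf⟩ := hA.exists_leaf
        (Set.nonempty_of_ncard_ne_zero (s := Φ) (by omega))
      obtain ⟨h, hhpt, hhM, hhf⟩ := ih (Φ \ {f}) (by
        rw [Set.ncard_sdiff_singleton_of_mem hf]; omega)
      -- an image of `f` that agrees with `h` on the shared element
      obtain ⟨g, hg, hgM, hgh⟩ : ∃ g ∈ C.rel f.1.1, (∀ q, M (f.1.2 q) (g q)) ∧
          ∀ q, ¬ A.IsPt (f.1.2 q) → (∃ f' ∈ Φ, f' ≠ f ∧ A.Occurs (f.1.2 q) f') →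
            g q = h (f.1.2 q) := by
        by_cases hsh : ∃ p, ¬ A.IsPt (f.1.2 p) ∧ ∃ f' ∈ Φ, f' ≠ f ∧ A.Occurs (f.1.2 p) f'
        · obtain ⟨p, hp, f', hf', hne, hocc⟩ := hsh
          obtain ⟨g, hg, hgp, hgM⟩ := hM.arc _ _ (hhM _ hp ⟨f', ⟨hf', hne⟩, hocc⟩) hp f p rfl
          refine ⟨g, hg, hgM, fun q hq hq' => ?_⟩
          have heq := hleaf _ _ hp hq ⟨p, rfl⟩ ⟨q, rfl⟩ ⟨f', hf', hne, hocc⟩ hq'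
          obtain rfl : p = q := by
            by_contra hpq
            exact hp (hA.isPt_of_eq f p q hpq heq)
          exact hgp
        · obtain ⟨g, hg, hgM⟩ := hfact f
          exact ⟨g, hg, hgM, fun q hq hq' => absurd ⟨q, hq, hq'⟩ hsh⟩
      let h' : A.dom → C.dom := fun x =>
        if hx : ¬ A.IsPt x ∧ ∃ q, f.1.2 q = x then g hx.2.choose else h x
      have hh'f : ∀ q, h' (f.1.2 q) = g q := by
        intro q
        by_cases hq : A.IsPt (f.1.2 q)
        · have hx : ¬ (¬ A.IsPt (f.1.2 q) ∧ ∃ q', f.1.2 q' = f.1.2 q) := fun hx => hx.1 hq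
          simp only [h', dif_neg hx]
          obtain ⟨i, hi⟩ := hq
          rw [← hi, hhpt]
          exact (hM.pt i (g q) (hi ▸ hgM q)).symm
        · have hx : ¬ A.IsPt (f.1.2 q) ∧ ∃ q', f.1.2 q' = f.1.2 q := ⟨hq, q, rfl⟩
          simp only [h', dif_pos hx]
          congr 1
          by_contra hne
          have := hA.isPt_of_eq f _ _ hne hx.2.choose_spec
          rw [hx.2.choose_spec] at this
          exact hq this
      have hh'h : ∀ x, (A.IsPt x ∨ ∃ f' ∈ Φ, f' ≠ f ∧ A.Occurs x f') → h' x = h x := by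
        intro x hx
        by_cases hx' : ¬ A.IsPt x ∧ ∃ q, f.1.2 q = x
        · obtain ⟨hpx, q, rfl⟩ := hx'
          rw [hh'f]
          exact hgh q hpx (hx.resolve_left hpx)
        · simp only [h', dif_neg hx']
      refine ⟨h', fun i => ?_, fun a ha ⟨f', hf', hocc⟩ => ?_, fun f' hf' => ?_⟩
      · rw [hh'h _ (.inl ⟨i, rfl⟩), hhpt]
      · by_cases hff : f' = f
        · subst hff
          obtain ⟨q, rfl⟩ := hocc
          rw [hh'f]
          exact hgM q
        · rw [hh'h _ (.inr ⟨f', hf', hff, hocc⟩)]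
          exact hhM a ha ⟨f', ⟨hf', hff⟩, hocc⟩
      · by_cases hff : f' = f
        · subst hff
          simpa only [hh'f] using hg
        · have := hhf f' ⟨hf', hff⟩
          simpa only [hh'h _ (.inr ⟨f', hf', hff, _, rfl⟩)] using this
  obtain ⟨h, hpt, -, hf⟩ := key _ Set.univ rfl
  exact ⟨h, hpt, fun r t ht => hf ⟨⟨r, t⟩, ht⟩ trivial⟩

/-- The pairs that are left after `s` rounds of arc consistency. -/
def arcStage (A C : Str S k) : ℕ → A.dom → C.dom → Prop
  | 0 => fun a c => ∀ i, A.pt i = a → c = C.pt i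
  | s + 1 => fun a c => arcStage A C s a c ∧ (¬ A.IsPt a → ∀ (f : A.Fact) p, f.1.2 p = a →
      ∃ g ∈ C.rel f.1.1, g p = c ∧ ∀ q, arcStage A C s (f.1.2 q) (g q))

theorem arcStage_anti {A C : Str S k} {a : A.dom} {c : C.dom} :
    Antitone fun s => arcStage A C s a c :=
  antitone_nat_of_succ_le fun _ h => h.1

/-- The pairs that are never removed form an arc consistent relation. -/
theorem isArcConsistent_arcStage (A C : Str S k) :
    IsArcConsistent A C fun a c => ∀ s, arcStage A C s a c := by
  refine ⟨fun i c h => h 0 i rfl, fun a c h ha f p hp => ?_⟩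
  -- one fact of the finite structure `C` is a witness in infinitely many rounds
  choose g hg using fun s => (h (s + 1)).2 ha f p hp
  obtain ⟨t, ht⟩ := Finite.exists_infinite_fiber g
  have hinf : (g ⁻¹' {t}).Infinite := Set.infinite_coe_iff.1 ht
  obtain ⟨s₀, hs₀ : g s₀ = t⟩ := hinf.nonempty
  refine ⟨t, hs₀ ▸ (hg s₀).1, hs₀ ▸ (hg s₀).2.1, fun q s => ?_⟩
  obtain ⟨s₁, hs₁ : g s₁ = t, hlt⟩ := hinf.exists_gt s
  exact arcStage_anti hlt.le (hs₁ ▸ (hg s₁).2.2 q)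

/-! ### The frontier of a fact-minimal forest -/

/-- The structure without the fact `f`. -/
def eraseFact (A : Str S k) (f : A.Fact) : Str S k where
  dom := A.dom
  finite_dom := A.finite_dom
  nonempty_dom := A.nonempty_dom
  rel r := {t | t ∈ A.rel r ∧ (⟨r, t⟩ : S.Atom A.dom) ≠ f.1}
  pt := A.pt

/-- No homomorphism from `A` to itself avoids a fact; so, up to elements without facts, `A` is a
core. -/
def IsFactMinimal (A : Str S k) : Prop := ∀ f : A.Fact, ¬ A.MapsTo (A.eraseFact f)

/-- Two copies of each element, with all facts that project to facts of `A`; the choice `τ` of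
copies for the distinguished elements may separate distinguished elements that are equal in `A`. -/
def split (A : Str S k) (τ : Fin k → Bool) : Str S k where
  dom := A.dom × Bool
  finite_dom := inferInstance
  nonempty_dom := inferInstance
  rel r := {t | (fun p => (t p).1) ∈ A.rel r}
  pt i := (A.pt i, τ i)

/-- The condition on the labels `l` of the elements of a copy of the fact `f` in the structure
`A.obstructed f₀`. Labels are facts that contain the element in question, or `none`. The label of an
element `a` that is not distinguished names a fact in which `a` cannot be mapped correctly, or is
`none` if no such fact is required; a copy of a distinguished element with a label different from
`none` is a substitute for it. A copy of `f` is admissible if it contains a substitute, or if no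
failure is recorded and `f` is not the fact `f₀`, or if a failure is recorded for each element and,
at some element, it concerns another fact than `f`. -/
def Admissible (A : Str S k) (f₀ f : A.Fact) (l : Fin (S.arity f.1.1) → Option A.Fact) : Prop :=
  (∀ q g, l q = some g → A.Occurs (f.1.2 q) g) ∧
  ((∃ q, A.IsPt (f.1.2 q) ∧ l q ≠ none) ∨
    (f ≠ f₀ ∧ ∀ q, ¬ A.IsPt (f.1.2 q) → l q = none) ∨
    ((∀ q, ¬ A.IsPt (f.1.2 q) → l q ≠ none) ∧ ∃ q, ¬ A.IsPt (f.1.2 q) ∧ l q ≠ some f))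

/-- The member of the frontier of `A` that is meant for structures in which the fact `f₀` is not
supported by arc consistency. -/
def obstructed (A : Str S k) (f₀ : A.Fact) : Str S k where
  dom := A.dom × Option A.Fact
  finite_dom := inferInstance
  nonempty_dom := inferInstance
  rel r := {t | ∃ h : (fun p => (t p).1) ∈ A.rel r,
    A.Admissible f₀ ⟨⟨r, fun p => (t p).1⟩, h⟩ fun p => (t p).2}
  pt i := (A.pt i, none)

theorem split_mapsTo (A : Str S k) (τ : Fin k → Bool) : (A.split τ).MapsTo A :=
  ⟨Prod.fst, fun _ => rfl, fun _ _ h => h⟩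

theorem obstructed_mapsTo (A : Str S k) (f₀ : A.Fact) : (A.obstructed f₀).MapsTo A :=
  ⟨Prod.fst, fun _ => rfl, fun _ _ h => h.1⟩

theorem not_mapsTo_split {A : Str S k} {τ : Fin k → Bool} {i j : Fin k} (h : A.pt i = A.pt j)
    (hτ : τ i ≠ τ j) : ¬ A.MapsTo (A.split τ) := by
  rintro ⟨g, hg, -⟩
  exact hτ (congrArg Prod.snd ((hg i).symm.trans ((congrArg g h).trans (hg j))))

/-- Some power of an endomorphism of a fact-minimal structure fixes all elements that occur in
facts. -/
theorem IsFactMinimal.exists_iterate {A : Str S k} (hA : A.IsFactMinimal) {e : A.dom → A.dom}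
    (hpt : ∀ i, e (A.pt i) = A.pt i) (he : ∀ r, ∀ t ∈ A.rel r, (fun p => e (t p)) ∈ A.rel r) :
    ∃ n, ∀ (f : A.Fact) p, e^[n + 1] (f.1.2 p) = f.1.2 p := by
  let E : A.Fact → A.Fact := fun f => ⟨⟨f.1.1, fun p => e (f.1.2 p)⟩, he _ _ f.2⟩
  have hsurj : Function.Surjective E := by
    intro f
    by_contra hf
    refine hA f ⟨e, hpt, fun r t ht => ⟨he r t ht, fun h => hf ⟨⟨⟨r, t⟩, ht⟩, Subtype.ext h⟩⟩⟩
  have hinj := Finite.injective_iff_surjective.2 hsurj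
  let σ : Equiv.Perm A.Fact := Equiv.ofBijective E ⟨hinj, hsurj⟩
  obtain ⟨n, hn, hσ⟩ := (isOfFinOrder_of_finite σ).exists_pow_eq_one
  obtain ⟨n, rfl⟩ : ∃ m, n = m + 1 := ⟨n - 1, by omega⟩
  have hE : ∀ m f, (E^[m] f).1 = ⟨f.1.1, fun p => e^[m] (f.1.2 p)⟩ := by
    intro m
    induction m with
    | zero => exact fun f => rfl
    | succ m ih => intro f; rw [Function.iterate_succ_apply, ih]; rfl
  refine ⟨n, fun f p => ?_⟩
  have h₁ : E^[n + 1] f = f := by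
    have := congrArg (fun τ : Equiv.Perm A.Fact => τ f) hσ
    rw [← Equiv.Perm.iterate_eq_pow] at this
    exact this
  have h₂ := (hE (n + 1) f).symm.trans (congrArg Subtype.val h₁)
  obtain ⟨⟨r, t⟩, ht⟩ := f
  exact congrFun (eq_of_heq (Sigma.mk.inj_iff.1 h₂).2) p

theorem IsForest.not_mapsTo_obstructed {A : Str S k} (hA : A.IsForest) (hmin : A.IsFactMinimal)
    (f₀ : A.Fact) : ¬ A.MapsTo (A.obstructed f₀) := by
  rintro ⟨g, hgpt, hg⟩
  let e : A.dom → A.dom := fun a => (g a).1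
  have hept : ∀ i, e (A.pt i) = A.pt i := fun i => congrArg Prod.fst (hgpt i)
  have he : ∀ r, ∀ t ∈ A.rel r, (fun p => e (t p)) ∈ A.rel r := fun r t ht => (hg r t ht).1
  obtain ⟨n, hn⟩ := hmin.exists_iterate hept he
  -- after composition with a power of the endomorphism `e`, each element is mapped to one of its
  -- own copies, which gives a label to each element
  let l : A.dom → Option A.Fact := fun a => (g (e^[n] a)).2
  have hlpt : ∀ a, A.IsPt a → l a = none := by
    rintro _ ⟨i, rfl⟩
    have h : e^[n] (A.pt i) = A.pt i := Function.iterate_fixed (hept i) n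
    simp only [l, h, hgpt]
    rfl
  have hl : ∀ f : A.Fact, A.Admissible f₀ f fun q => l (f.1.2 q) := by
    intro f
    have hpow : ∀ m, (fun p => e^[m] (f.1.2 p)) ∈ A.rel f.1.1 := by
      intro m
      induction m with
      | zero => exact f.2
      | succ m ih =>
        simp only [Function.iterate_succ_apply']
        exact he _ _ ih
    obtain ⟨h₁, h₂⟩ := hg _ _ (hpow n)
    have h₃ : (fun p => (g (e^[n] (f.1.2 p))).1) = f.1.2 := by
      funext p
      exact (Function.iterate_succ_apply' e n _).symm.trans (hn f p)
    have aux : ∀ (t : Fin (S.arity f.1.1) → A.dom) (h : t ∈ A.rel f.1.1), t = f.1.2 →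
        A.Admissible f₀ ⟨⟨f.1.1, t⟩, h⟩ (fun q => l (f.1.2 q)) →
        A.Admissible f₀ f fun q => l (f.1.2 q) := by
      rintro _ h rfl
      exact fun h => h
    exact aux _ h₁ h₃ h₂
  let T := {f : A.Fact // (∀ q, ¬ A.IsPt (f.1.2 q) → l (f.1.2 q) ≠ none) ∧
    ∃ q, ¬ A.IsPt (f.1.2 q) ∧ l (f.1.2 q) ≠ some f}
  have hnext : ∀ f : T, ∃ (a : A.dom) (f' : T), ¬ A.IsPt a ∧ A.Occurs a f.1 ∧ A.Occurs a f'.1 ∧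
      f.1 ≠ f'.1 ∧ l a = some f'.1 ∧ l a ≠ some f.1 := by
    rintro ⟨f, hf, q, hq, hqf⟩
    obtain ⟨f', hf'⟩ := Option.ne_none_iff_exists'.1 (hf q hq)
    obtain ⟨p, hp⟩ := (hl f).1 q f' hf'
    refine ⟨f.1.2 q, ⟨f', ?_⟩, hq, ⟨q, rfl⟩, ⟨p, hp⟩,
      fun h => hqf (hf'.trans (congrArg some h.symm)), hf', hqf⟩
    rcases (hl f').2 with ⟨p', hp', hne⟩ | ⟨-, h⟩ | h
    · exact absurd (hlpt _ hp') hne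
    · have := h p (hp ▸ hq)
      simp only [hp, hf'] at this
      exact absurd this (by simp)
    · exact h
  choose a next hpt hocc hocc' hne ha ha' using hnext
  have h₀ : T := ⟨f₀, by
    rcases (hl f₀).2 with ⟨p', hp', hne⟩ | ⟨h, -⟩ | h
    · exact absurd (hlpt _ hp') hne
    · exact absurd rfl h
    · exact h⟩
  have hx : ∀ i, next^[i + 1] h₀ = next (next^[i] h₀) :=
    fun i => Function.iterate_succ_apply' _ _ _
  refine hA.no_walk (fun i => (next^[i] h₀).1) (fun i => a (next^[i] h₀)) (fun i => hpt _)
    (fun i => hocc _) (fun i => ?_) (fun i => ?_) (fun i h => ?_)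
  · simpa only [hx] using hocc' _
  · simpa only [hx] using hne _
  · simp only [hx] at h
    exact ha' _ (h ▸ ha _)

/-- A structure that maps to `A`, and in which some equality between distinguished elements of `A`
fails, maps to a split copy of `A`. -/
theorem exists_mapsTo_split {A C : Str S k} (h : C.MapsTo A) {i j : Fin k}
    (hij : A.pt i = A.pt j) (hC : C.pt i ≠ C.pt j) :
    ∃ τ : Fin k → Bool, (∃ i j, A.pt i = A.pt j ∧ τ i ≠ τ j) ∧ C.MapsTo (A.split τ) := by
  classical
  obtain ⟨h, hpt, hrel⟩ := h
  refine ⟨fun l => decide (C.pt l = C.pt i), ⟨i, j, hij, by simpa using hC.symm⟩,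
    fun c => (h c, decide (c = C.pt i)), fun l => ?_, hrel⟩
  exact Prod.ext (hpt l) rfl

/-- A structure that maps to the forest `A`, satisfies the equalities between distinguished
elements of `A` and does not admit a homomorphism from `A` maps to an obstructed copy of `A`: an
element above `a` gets as its label the fact that causes the removal of the pair in the arc
consistency procedure. In a fact, a pair that is removed first cannot be removed because of this
fact. -/
theorem IsForest.exists_mapsTo_obstructed {A C : Str S k} (hA : A.IsForest) (hCA : C.MapsTo A)
    (hAC : ¬ A.MapsTo C) (hpt : ∀ i j, A.pt i = A.pt j → C.pt i = C.pt j) :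
    ∃ f₀, C.MapsTo (A.obstructed f₀) := by
  classical
  obtain ⟨h, hhpt, hhrel⟩ := hCA
  have hM := isArcConsistent_arcStage A C
  obtain ⟨f₀, hf₀⟩ : ∃ f₀ : A.Fact, ¬ ∃ g ∈ C.rel f₀.1.1, ∀ q s,
      arcStage A C s (f₀.1.2 q) (g q) := by
    by_contra! hcon
    exact hAC (hA.mapsTo hpt hM hcon)
  -- the elements all of whose pairs are removed
  let W : A.dom → Prop := fun a => ∀ c, ∃ s, ¬ arcStage A C s a c
  have hW : ∀ (f : A.Fact) p q, ¬ A.IsPt (f.1.2 q) → W (f.1.2 p) → W (f.1.2 q) := by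
    intro f p q hq hp c
    by_contra! hcon
    obtain ⟨g, -, -, hg⟩ := hM.arc _ c hcon hq f q rfl
    obtain ⟨s, hs⟩ := hp (g p)
    exact hs (hg p s)
  have hW₀ : ∀ q, ¬ A.IsPt (f₀.1.2 q) → W (f₀.1.2 q) := by
    intro q hq c
    by_contra! hcon
    obtain ⟨g, hg, -, hgM⟩ := hM.arc _ c hcon hq f₀ q rfl
    exact hf₀ ⟨g, hg, hgM⟩
  -- the round in which a pair is removed, and the fact that is responsible
  have hreason : ∀ a c, ¬ A.IsPt a → W a → ∃ (s : ℕ) (f : A.Fact) (p : _),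
      f.1.2 p = a ∧ arcStage A C s a c ∧ ¬ arcStage A C (s + 1) a c ∧
      ¬ ∃ g ∈ C.rel f.1.1, g p = c ∧ ∀ q, arcStage A C s (f.1.2 q) (g q) := by
    intro a c ha hWa
    have hex := hWa c
    obtain ⟨s, hs⟩ : ∃ s, Nat.find hex = s + 1 := by
      refine ⟨Nat.find hex - 1, ?_⟩
      have : Nat.find hex ≠ 0 := fun h0 => by
        have := Nat.find_spec hex
        rw [h0] at this
        exact this fun i hi => absurd ⟨i, hi⟩ ha
      omega
    have h₁ := Nat.find_spec hex
    have h₂ := Nat.find_min hex (m := s) (by omega)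
    rw [hs] at h₁
    rw [not_not] at h₂
    have h₃ : ¬ (¬ A.IsPt a → ∀ (f : A.Fact) p, f.1.2 p = a →
        ∃ g ∈ C.rel f.1.1, g p = c ∧ ∀ q, arcStage A C s (f.1.2 q) (g q)) :=
      fun h => h₁ ⟨h₂, h⟩
    push Not at h₃
    obtain ⟨-, f, p, hp, h₃⟩ := h₃
    refine ⟨s, f, p, hp, h₂, h₁, ?_⟩
    push Not
    exact h₃
  have hlab : ∀ c, ∃ o : Option A.Fact, (∀ g, o = some g → A.Occurs (h c) g) ∧
      (A.IsPt (h c) → (∃ i, C.pt i = c) → o = none) ∧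
      (A.IsPt (h c) → (¬ ∃ i, C.pt i = c) → (∃ f, A.Occurs (h c) f) → o ≠ none) ∧
      (¬ A.IsPt (h c) → ¬ W (h c) → o = none) ∧
      (¬ A.IsPt (h c) → W (h c) → ∃ s f p, o = some f ∧ f.1.2 p = h c ∧ arcStage A C s (h c) c ∧
        ¬ arcStage A C (s + 1) (h c) c ∧
        ¬ ∃ g ∈ C.rel f.1.1, g p = c ∧ ∀ q, arcStage A C s (f.1.2 q) (g q)) := by
    intro c
    by_cases hpc : A.IsPt (h c)
    · by_cases hc : (¬ ∃ i, C.pt i = c) ∧ ∃ f, A.Occurs (h c) f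
      · obtain ⟨hc, f, hf⟩ := hc
        exact ⟨some f, fun g hg => Option.some_injective _ hg ▸ hf, fun _ h => absurd h hc,
          fun _ _ _ => by simp, fun h => absurd hpc h, fun h => absurd hpc h⟩
      · exact ⟨none, by simp, fun _ _ => rfl, fun _ h₁ h₂ => absurd ⟨h₁, h₂⟩ hc,
          fun h => absurd hpc h, fun h => absurd hpc h⟩
    · by_cases hWc : W (h c)
      · obtain ⟨s, f, p, hp, h₁, h₂, h₃⟩ := hreason _ c hpc hWc
        exact ⟨some f, fun g hg => Option.some_injective _ hg ▸ ⟨p, hp⟩, fun h => absurd h hpc,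
          fun h => absurd h hpc, fun _ h => absurd hWc h, fun _ _ => ⟨s, f, p, rfl, hp, h₁, h₂, h₃⟩⟩
      · exact ⟨none, by simp, fun h => absurd h hpc, fun h => absurd h hpc, fun _ _ => rfl,
          fun _ h => absurd h hWc⟩
  choose lab hocc hreal hfake hplain hfail using hlab
  have hstage : ∀ i s, arcStage A C s (h (C.pt i)) (C.pt i) := by
    intro i s
    induction s with
    | zero => exact fun j hj => hpt _ _ ((hhpt i).symm.trans hj.symm)
    | succ s ih => exact ⟨ih, fun hi => absurd ⟨i, (hhpt i).symm⟩ hi⟩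
  refine ⟨f₀, fun c => (h c, lab c),
    fun i => Prod.ext (hhpt i) (hreal _ ⟨i, (hhpt i).symm⟩ ⟨i, rfl⟩),
    fun r t ht => ⟨hhrel r t ht, fun q => hocc (t q), ?_⟩⟩
  by_cases hsub : ∃ q, A.IsPt (h (t q)) ∧ ¬ ∃ i, C.pt i = t q
  · obtain ⟨q, hq, hq'⟩ := hsub
    exact .inl ⟨q, hq, hfake _ hq hq' ⟨⟨⟨r, fun p => h (t p)⟩, hhrel r t ht⟩, q, rfl⟩⟩
  push Not at hsub
  have hdist : ∀ q s, A.IsPt (h (t q)) → arcStage A C s (h (t q)) (t q) := by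
    intro q s hq
    obtain ⟨i, hi⟩ := hsub q hq
    exact hi ▸ hstage i s
  by_cases hex : ∃ q, ¬ A.IsPt (h (t q)) ∧ W (h (t q))
  · obtain ⟨q₀, hq₀, hWq₀⟩ := hex
    have hWall : ∀ q, ¬ A.IsPt (h (t q)) → W (h (t q)) := fun q hq =>
      hW ⟨⟨r, fun p => h (t p)⟩, hhrel r t ht⟩ q₀ q hq hWq₀
    refine .inr (.inr ⟨fun q hq => ?_, ?_⟩)
    · obtain ⟨s, f, p, hf, -⟩ := hfail _ hq (hWall q hq)
      simp [hf]
    -- a pair of the fact that is removed first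
    · have hrem : ∃ s q, ¬ A.IsPt (h (t q)) ∧ ¬ arcStage A C (s + 1) (h (t q)) (t q) := by
        obtain ⟨s, f, p, -, -, -, hs, -⟩ := hfail _ hq₀ hWq₀
        exact ⟨s, q₀, hq₀, hs⟩
      obtain ⟨q, hq, hqs⟩ := Nat.find_spec hrem
      have hall : ∀ q, arcStage A C (Nat.find hrem) (h (t q)) (t q) := by
        intro q'
        by_cases hq' : A.IsPt (h (t q'))
        · exact hdist q' _ hq'
        · by_contra hcon
          cases hs : Nat.find hrem with
          | zero =>
            rw [hs] at hcon
            exact hcon fun i hi => absurd ⟨i, hi⟩ hq'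
          | succ s =>
            rw [hs] at hcon
            exact Nat.find_min hrem (m := s) (by omega) ⟨q', hq', hcon⟩
      obtain ⟨s, f, p, hf, hp, h₁, h₂, h₃⟩ := hfail _ hq (hWall q hq)
      refine ⟨q, hq, fun hcon => h₃ ?_⟩
      obtain rfl := Option.some_injective _ (hf.symm.trans hcon)
      have hs : s = Nat.find hrem := by
        rcases lt_trichotomy s (Nat.find hrem) with hlt | heq | hlt
        · exact absurd (arcStage_anti hlt (hall q)) h₂
        · exact heq
        · exact absurd (arcStage_anti hlt h₁) hqs
      have hpq : p = q := by
        by_contra hne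
        have := hA.isPt_of_eq _ p q hne hp
        exact hq (hp ▸ this)
      exact ⟨t, ht, congrArg t hpq, fun q' => hs ▸ hall q'⟩
  · push Not at hex
    refine .inr (.inl ⟨?_, fun q hq => hplain _ hq (hex q hq)⟩)
    rintro rfl
    exact hf₀ ⟨t, ht, fun q s => hdist q s (by_contra fun hq => hex q hq (hW₀ q hq))⟩

/-- The split and the obstructed copies form a frontier of a fact-minimal forest. -/
theorem IsForest.isFrontier {A : Str S k} (hA : A.IsForest) (hmin : A.IsFactMinimal) :
    IsFrontier Set.univ ({B | ∃ τ : Fin k → Bool, (∃ i j, A.pt i = A.pt j ∧ τ i ≠ τ j) ∧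
      B = A.split τ} ∪ {B | ∃ f₀, B = A.obstructed f₀}) A := by
  refine ⟨?_, ?_, fun C _ hCA hAC => ?_⟩
  · rintro B (⟨τ, -, rfl⟩ | ⟨f₀, rfl⟩)
    exacts [A.split_mapsTo τ, A.obstructed_mapsTo f₀]
  · rintro B (⟨τ, ⟨i, j, hij, hτ⟩, rfl⟩ | ⟨f₀, rfl⟩)
    exacts [not_mapsTo_split hij hτ, hA.not_mapsTo_obstructed hmin f₀]
  · by_cases hpt : ∀ i j, A.pt i = A.pt j → C.pt i = C.pt j
    · obtain ⟨f₀, h⟩ := hA.exists_mapsTo_obstructed hCA hAC hpt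
      exact ⟨_, .inr ⟨f₀, rfl⟩, h⟩
    · push Not at hpt
      obtain ⟨i, j, hij, hC⟩ := hpt
      obtain ⟨τ, hτ, h⟩ := exists_mapsTo_split hCA hij hC
      exact ⟨_, .inl ⟨τ, hτ, rfl⟩, h⟩

end Str

/-! ### Typed and untyped descriptions -/

/-- The untyped form of a fact. -/
def Schema.Atom.raw {S : Schema} {n : ℕ} (f : S.Atom (Fin n)) : RawFact :=
  (f.1, List.ofFn fun p => (f.2 p : ℕ))

theorem Schema.Atom.raw_injective {S : Schema} {n : ℕ} :
    Function.Injective (Schema.Atom.raw : S.Atom (Fin n) → RawFact) := by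
  rintro ⟨r, t⟩ ⟨r', t'⟩ h
  simp only [Schema.Atom.raw, Prod.mk.injEq] at h
  obtain ⟨h₁, h₂⟩ := h
  obtain rfl := Fin.ext h₁
  have := List.ofFn_injective h₂
  congr 1
  funext p
  exact Fin.ext (congrFun this p)

theorem List.mem_zip_ofFn {α β : Type*} {n : ℕ} {f : Fin n → α} {g : Fin n → β} {x : α × β} :
    x ∈ (List.ofFn f).zip (List.ofFn g) ↔ ∃ q, f q = x.1 ∧ g q = x.2 := by
  have : (List.ofFn f).zip (List.ofFn g) = List.ofFn fun q => (f q, g q) := by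
    apply List.ext_getElem <;> simp
  rw [this, List.mem_ofFn]
  simp [Prod.ext_iff]

theorem RawFact.related_raw {S : Schema} {n : ℕ} {M : List (ℕ × ℕ)} {f g : S.Atom (Fin n)} :
    RawFact.related M f.raw g.raw = true ↔
      ∃ t, g = ⟨f.1, t⟩ ∧ ∀ q, ((f.2 q : ℕ), (t q : ℕ)) ∈ M := by
  obtain ⟨r, t⟩ := f
  obtain ⟨r', t'⟩ := g
  simp only [RawFact.related, Schema.Atom.raw, Bool.and_eq_true, beq_iff_eq, List.all_eq_true,
    List.contains_iff_mem]
  constructor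
  · rintro ⟨h, h'⟩
    obtain rfl := Fin.ext h
    exact ⟨t', rfl, fun q => h' _ (List.mem_zip_ofFn.2 ⟨q, rfl, rfl⟩)⟩
  · rintro ⟨t₁, h, h'⟩
    cases h
    refine ⟨rfl, fun x hx => ?_⟩
    obtain ⟨q, hq, hq'⟩ := List.mem_zip_ofFn.1 hx
    exact (Prod.ext hq hq' : (_, _) = x) ▸ h' q

namespace Presentation

variable {S : Schema} {k : ℕ}

/-- The list of distinguished elements. -/
def rawPts (P : Presentation S k) : List ℕ := List.ofFn fun i => (P.pt i : ℕ)

/-- The untyped form of a presentation. -/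
def raw (P : Presentation S k) : RawStr := (P.n, P.facts.map Schema.Atom.raw, P.rawPts)

theorem encode_eq (P : Presentation S k) : P.encode = toData P.raw := by
  simp [encode, raw, rawPts, toData, Schema.Atom.raw, Function.comp_def]

theorem raw_injective : Function.Injective (raw : Presentation S k → RawStr) := by
  rintro ⟨n, hn, F, p⟩ ⟨n', hn', F', p'⟩ h
  simp only [raw, rawPts, Prod.mk.injEq] at h
  obtain ⟨rfl, h₁, h₂⟩ := h
  obtain rfl := Schema.Atom.raw_injective.list_map h₁
  have := List.ofFn_injective h₂
  obtain rfl : p = p' := funext fun i => Fin.ext (congrFun this i)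
  rfl

theorem mem_rawPts {P : Presentation S k} {a : Fin P.n} :
    (a : ℕ) ∈ P.rawPts ↔ P.toStr.IsPt a := by
  simp only [rawPts, List.mem_ofFn, Str.IsPt, toStr, Fin.ext_iff]

/-- The presentation with a different list of facts. -/
def withFacts (P : Presentation S k) (G : List (S.Atom (Fin P.n))) : Presentation S k where
  n := P.n
  n_pos := P.n_pos
  facts := G
  pt := P.pt

theorem withFacts_mapsTo {P : Presentation S k} {G G' : List (S.Atom (Fin P.n))} (h : G ⊆ G') :
    (P.withFacts G).toStr.MapsTo (P.withFacts G').toStr :=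
  ⟨fun a => a, fun _ => rfl, fun _ _ ht => h ht⟩

theorem isForest_withFacts {P : Presentation S k} (hP : P.toStr.IsForest)
    {G : List (S.Atom (Fin P.n))} (h : G ⊆ P.facts) : (P.withFacts G).toStr.IsForest := by
  let φ : (P.withFacts G).toStr.Fact → P.toStr.Fact := fun f => ⟨f.1, h f.2⟩
  have hφ : ∀ f g, φ f = φ g → f = g := fun f g e =>
    Subtype.ext (congrArg Subtype.val e : (φ f).1 = (φ g).1)
  exact ⟨fun f => hP.isPt_of_eq (φ f), fun f a h₁ h₂ h₃ h₄ =>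
    hP.no_walk (fun i => φ (f i)) a h₁ h₂ h₃ fun i hi => h₄ i (hφ _ _ hi)⟩

end Presentation

/-! ### Correctness of the arc consistency test -/

theorem mem_arcInit {n : ℕ} {pts : List ℕ} {a c : ℕ} :
    (a, c) ∈ arcInit n pts ↔ a < n ∧ c < n ∧ (a ∈ pts → a = c) := by
  simp only [arcInit, List.mem_flatMap, List.mem_map, List.mem_filter, List.mem_range,
    Bool.or_eq_true, Bool.not_eq_true', beq_iff_eq, Prod.mk.injEq]
  constructor
  · rintro ⟨a', ha, c', ⟨hc, h⟩, rfl, rfl⟩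
    refine ⟨ha, hc, fun hp => h.resolve_left ?_⟩
    simpa using hp
  · rintro ⟨ha, hc, h⟩
    refine ⟨a, ha, c, ⟨hc, ?_⟩, rfl, rfl⟩
    by_cases hp : a ∈ pts
    · exact .inr (h hp)
    · exact .inl (by simpa using hp)

theorem arcStep_sublist (pts : List ℕ) (F G : List RawFact) (M : List (ℕ × ℕ)) :
    (arcStep pts F G M).Sublist M := List.filter_sublist

theorem List.foldl_const_eq_iterate {α β : Type*} (f : β → β) (l : List α) (x : β) :
    l.foldl (fun y _ => f y) x = f^[l.length] x := by
  induction l generalizing x with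
  | nil => rfl
  | cons a l ih => rw [List.foldl_cons, ih]; rfl

/-- Removing members from a list again and again becomes stationary after at most as many rounds as
the list has members. -/
theorem List.iterate_fixed_of_sublist {α : Type*} {f : List α → List α}
    (hf : ∀ l, (f l).Sublist l) (n : ℕ) (l : List α) (hl : l.length ≤ n) :
    f (f^[n] l) = f^[n] l := by
  induction n generalizing l with
  | zero =>
    obtain rfl := List.length_eq_zero_iff.1 (Nat.le_zero.1 hl)
    exact List.sublist_nil.1 (hf [])
  | succ n ih =>
    by_cases h : f l = l
    · have : f^[n + 1] l = l := Function.iterate_fixed h _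
      rw [this, h]
    · refine ih (f l) ?_
      have h₁ := (hf l).length_le
      have h₂ : (f l).length ≠ l.length := fun he => h ((hf l).eq_of_length he)
      omega

theorem arcStep_arcFix (n : ℕ) (pts : List ℕ) (F G : List RawFact) :
    arcStep pts F G (arcFix n pts F G) = arcFix n pts F G := by
  rw [arcFix, List.foldl_const_eq_iterate]
  exact List.iterate_fixed_of_sublist (arcStep_sublist pts F G) _ _ le_rfl

/-- A set of pairs that survives each round survives the whole procedure. -/
theorem mem_arcFix_of_forall {n : ℕ} {pts : List ℕ} {F G : List RawFact} {X : Set (ℕ × ℕ)}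
    (h₀ : ∀ x ∈ X, x ∈ arcInit n pts)
    (h : ∀ M : List (ℕ × ℕ), (∀ x ∈ X, x ∈ M) → ∀ x ∈ X, x ∈ arcStep pts F G M) :
    ∀ x ∈ X, x ∈ arcFix n pts F G := by
  rw [arcFix, List.foldl_const_eq_iterate]
  generalize (arcInit n pts).length = m
  induction m with
  | zero => exact h₀
  | succ m ih =>
    rw [Function.iterate_succ_apply']
    exact h _ ih

theorem arcFix_subset (n : ℕ) (pts : List ℕ) (F G : List RawFact) :
    arcFix n pts F G ⊆ arcInit n pts := by
  rw [arcFix, List.foldl_const_eq_iterate]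
  generalize (arcInit n pts).length = m
  induction m with
  | zero => exact fun _ h => h
  | succ m ih =>
    rw [Function.iterate_succ_apply']
    exact List.Subset.trans (arcStep_sublist _ _ _ _).subset ih

namespace Presentation

variable {S : Schema} {k : ℕ}

theorem homTest_iff {P : Presentation S k} (hP : P.toStr.IsForest)
    (G : List (S.Atom (Fin P.n))) :
    homTest P.n P.rawPts (P.facts.map Schema.Atom.raw) (G.map Schema.Atom.raw) = true ↔
      P.toStr.MapsTo (P.withFacts G).toStr := by
  set M := arcFix P.n P.rawPts (P.facts.map Schema.Atom.raw) (G.map Schema.Atom.raw) with hM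
  have htest : homTest P.n P.rawPts (P.facts.map Schema.Atom.raw) (G.map Schema.Atom.raw) = true ↔
      ∀ f ∈ P.facts, ∃ g ∈ G, RawFact.related M f.raw g.raw = true := by
    simp [homTest, ← hM]
  rw [htest]
  constructor
  · intro h
    refine hP.mapsTo (C := (P.withFacts G).toStr) (fun i j h => h)
      (M := fun a c : Fin P.n => ((a : ℕ), (c : ℕ)) ∈ M) ⟨fun i c hc => ?_, ?_⟩ ?_
    · exact (Fin.ext ((mem_arcInit.1 (arcFix_subset _ _ _ _ hc)).2.2
        (mem_rawPts.2 ⟨i, rfl⟩))).symm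
    · intro (a : Fin P.n) (c : Fin P.n) hac ha f p hp
      rw [hM, ← arcStep_arcFix, ← hM, arcStep, List.mem_filter, Bool.or_eq_true] at hac
      have h₁ := hac.2.resolve_left fun h' => ha (mem_rawPts.1 (List.contains_iff_mem.1 h'))
      rw [arcConsistent, List.all_eq_true] at h₁
      have h₂ := h₁ _ (List.mem_map_of_mem (f := Schema.Atom.raw) f.2)
      rw [Bool.or_eq_true] at h₂
      have h₃ := h₂.resolve_left (by
        have : (a : ℕ) ∈ (Schema.Atom.raw (⟨f.1.1, f.1.2⟩ : S.Atom (Fin P.n))).2 :=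
          List.mem_ofFn.2 ⟨p, by rw [hp]⟩
        simpa using this)
      obtain ⟨_, hg, h₄⟩ := List.any_eq_true.1 h₃
      obtain ⟨g, hg', rfl⟩ := List.mem_map.1 hg
      rw [Bool.and_eq_true] at h₄
      obtain ⟨t, rfl, ht⟩ := RawFact.related_raw.1 h₄.1
      obtain ⟨q, hq, hq'⟩ := List.mem_zip_ofFn.1 (List.contains_iff_mem.1 h₄.2)
      have hqa : f.1.2 q = a := Fin.ext hq
      have hpq : p = q := by
        by_contra hne
        exact ha (hp ▸ hP.isPt_of_eq f p q hne (hp.trans hqa.symm))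
      exact ⟨t, hg', hpq ▸ Fin.ext hq', ht⟩
    · intro f
      obtain ⟨g, hg, hfg⟩ := h f.1 f.2
      obtain ⟨t, rfl, ht⟩ := RawFact.related_raw.1 hfg
      exact ⟨t, hg, ht⟩
  · rintro ⟨(h : Fin P.n → Fin P.n), hpt, hrel⟩ f hf
    have key : ∀ x ∈ Set.range fun a : Fin P.n => ((a : ℕ), (h a : ℕ)), x ∈ M := by
      refine mem_arcFix_of_forall ?_ ?_
      · rintro _ ⟨a, rfl⟩
        refine mem_arcInit.2 ⟨a.2, (h a).2, fun ha => ?_⟩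
        obtain ⟨i, rfl⟩ := mem_rawPts.1 ha
        exact congrArg Fin.val (hpt i).symm
      · rintro N hN _ ⟨a, rfl⟩
        refine List.mem_filter.2 ⟨hN _ ⟨a, rfl⟩, ?_⟩
        rw [Bool.or_eq_true]
        right
        rw [arcConsistent, List.all_eq_true]
        intro f' hf'
        obtain ⟨f, hf, rfl⟩ := List.mem_map.1 hf'
        rw [Bool.or_eq_true]
        by_cases ha : (a : ℕ) ∈ f.raw.2
        · right
          obtain ⟨q, hq⟩ := List.mem_ofFn.1 ha
          refine List.any_eq_true.2 ⟨_, List.mem_map_of_mem (hrel f.1 f.2 hf), ?_⟩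
          rw [Bool.and_eq_true]
          refine ⟨RawFact.related_raw.2 ⟨_, rfl, fun q => hN _ ⟨f.2 q, rfl⟩⟩,
            List.contains_iff_mem.2 (List.mem_zip_ofFn.2 ⟨q, hq, ?_⟩)⟩
          exact congrArg (fun x => (h x : ℕ)) (Fin.ext hq : f.2 q = a)
        · left
          simpa using ha
    exact ⟨_, hrel f.1 f.2 hf, RawFact.related_raw.2 ⟨_, rfl, fun q => key _ ⟨f.2 q, rfl⟩⟩⟩

end Presentation

/-! ### Greedy minimization -/

theorem greedy_spec {α : Type} {t : List α → Bool} {l : List α}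
    (hmono : ∀ m m', m ⊆ m' → m' ⊆ l → t m = true → t m' = true) (hl : t l = true) :
    greedy t l ⊆ l ∧ t (greedy t l) = true ∧
      ∀ d₁ a d₂, greedy t l = d₁ ++ a :: d₂ → ¬ t (d₁ ++ d₂) = true := by
  have key : ∀ todo d : List α, d ++ todo ⊆ l → t (d ++ todo) = true →
      (∀ d₁ a d₂, d = d₁ ++ a :: d₂ → ¬ t (d₁ ++ d₂ ++ todo) = true) →
      let g := (todo.foldl (fun s _ => greedyStep t s) (d, todo)).1
      g ⊆ l ∧ t g = true ∧ ∀ d₁ a d₂, g = d₁ ++ a :: d₂ → ¬ t (d₁ ++ d₂) = true := by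
    intro todo
    induction todo with
    | nil =>
      intro d
      simpa using fun h₁ h₂ h₃ => ⟨h₁, h₂, h₃⟩
    | cons b todo ih =>
      intro d hsub ht hmin
      rw [List.foldl_cons]
      have hsub' : d ++ todo ⊆ d ++ b :: todo := by intro x; simp; tauto
      have hsub'' : b :: d ++ todo ⊆ d ++ b :: todo := by intro x; simp; tauto
      by_cases hb : t (d ++ todo) = true
      · simp only [greedyStep, hb, if_true]
        refine ih d (List.Subset.trans hsub' hsub) hb fun d₁ a d₂ h h' => hmin d₁ a d₂ h
          (hmono _ _ ?_ (fun x hx => hsub ?_) h')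
        · intro x; simp; tauto
        · subst h
          revert hx; simp; tauto
      · simp only [greedyStep, hb, if_false, Bool.false_eq_true]
        refine ih (b :: d) (List.Subset.trans hsub'' hsub)
          (hmono _ _ ?_ (List.Subset.trans hsub'' hsub) ht) ?_
        · intro x; simp; tauto
        · intro d₁ a d₂ h
          rcases d₁ with _ | ⟨b', d₁⟩
          · obtain ⟨-, rfl⟩ := List.cons_eq_cons.1 h
            simpa using hb
          · obtain ⟨rfl, rfl⟩ := List.cons_eq_cons.1 h
            intro h'
            refine hmin d₁ a d₂ rfl (hmono _ _ ?_ (fun x hx => hsub ?_) h')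
            · intro x; simp; tauto
            · revert hx; simp; tauto
  exact key l [] (by simp) (by simpa using hl) (by simp)

namespace Presentation

variable {S : Schema} {k : ℕ}

/-- The facts that remain after the minimization, and the properties of the structure that they
form. -/
theorem exists_core {P : Presentation S k} (hP : P.toStr.IsForest) :
    ∃ G : List (S.Atom (Fin P.n)),
      rawCore P.n P.rawPts (P.facts.map Schema.Atom.raw) = G.map Schema.Atom.raw ∧ G.Nodup ∧
      (P.withFacts G).toStr.IsForest ∧ (P.withFacts G).toStr.IsFactMinimal ∧
      P.toStr.MapsTo (P.withFacts G).toStr ∧ (P.withFacts G).toStr.MapsTo P.toStr := by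
  have hlift : ∀ m : List RawFact, m ⊆ P.facts.map Schema.Atom.raw →
      ∃ G : List (S.Atom (Fin P.n)), G.map Schema.Atom.raw = m ∧ G ⊆ P.facts := by
    intro m
    induction m with
    | nil => exact fun _ => ⟨[], rfl, by simp⟩
    | cons x m ih =>
      intro h
      obtain ⟨hx, hm⟩ := List.cons_subset.1 h
      obtain ⟨f, hf, rfl⟩ := List.mem_map.1 hx
      obtain ⟨G, rfl, hG⟩ := ih hm
      exact ⟨f :: G, rfl, List.cons_subset.2 ⟨hf, hG⟩⟩
  have hmap : ∀ {G G' : List (S.Atom (Fin P.n))},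
      G.map Schema.Atom.raw ⊆ G'.map Schema.Atom.raw → G ⊆ G' := fun h f hf =>
    (List.mem_map_of_injective Schema.Atom.raw_injective).1 (h (List.mem_map_of_mem hf))
  obtain ⟨hsub, htest, hmin⟩ := greedy_spec
    (t := homTest P.n P.rawPts (P.facts.map Schema.Atom.raw))
    (l := P.facts.map Schema.Atom.raw) (by
      intro m m' h h' ht
      obtain ⟨G', rfl, -⟩ := hlift m' h'
      obtain ⟨G, rfl, -⟩ := hlift m (List.Subset.trans h h')
      rw [homTest_iff hP] at ht ⊢
      exact ht.trans (withFacts_mapsTo (hmap h))) ((homTest_iff hP _).2 (Str.MapsTo.refl _))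
  obtain ⟨G, hG, hGsub⟩ := hlift _ hsub
  rw [← hG, homTest_iff hP] at htest
  have hmin' : ∀ d₁ f d₂, G = d₁ ++ f :: d₂ →
      ¬ P.toStr.MapsTo (P.withFacts (d₁ ++ d₂)).toStr := by
    intro d₁ f d₂ h hmaps
    refine hmin (d₁.map Schema.Atom.raw) f.raw (d₂.map Schema.Atom.raw) ?_ ?_
    · rw [← hG, h, List.map_append, List.map_cons]
    · rw [← List.map_append]
      exact (homTest_iff hP _).2 hmaps
  -- a fact is not listed twice, since one of the two occurrences could be dropped
  have hnotin : ∀ d₁ f d₂, G = d₁ ++ f :: d₂ → f ∉ d₁ ++ d₂ := by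
    intro d₁ f d₂ h hf
    refine hmin' d₁ f d₂ h (htest.trans (withFacts_mapsTo ?_))
    intro x hx
    rw [h, List.mem_append, List.mem_cons] at hx
    rcases hx with hx | rfl | hx
    · exact List.mem_append_left _ hx
    · exact hf
    · exact List.mem_append_right _ hx
  refine ⟨G, hG.symm, ?_, isForest_withFacts hP hGsub, ?_, htest, ?_⟩
  · rw [List.nodup_iff_sublist]
    intro f hf
    obtain ⟨d₁, d₂, rfl⟩ := List.append_of_mem (hf.subset List.mem_cons_self)
    have h := hnotin d₁ f d₂ rfl
    rw [List.mem_append, not_or] at h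
    have hc := hf.count_le f
    rw [List.count_append, List.count_cons_self (l := d₂), List.count_eq_zero.2 h.1,
      List.count_eq_zero.2 h.2] at hc
    simp at hc
  · rintro ⟨(f : S.Atom (Fin P.n)), hf⟩ hmaps
    obtain ⟨d₁, d₂, h⟩ : ∃ d₁ d₂ : List (S.Atom (Fin P.n)), G = d₁ ++ f :: d₂ :=
      List.append_of_mem (show f ∈ G from hf)
    refine hmin' d₁ f d₂ h (htest.trans (hmaps.trans ⟨fun a => a, fun _ => rfl, ?_⟩))
    rintro r t ⟨ht, hne⟩
    change (⟨r, t⟩ : S.Atom (Fin P.n)) ∈ G at ht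
    rw [h, List.mem_append, List.mem_cons] at ht
    rcases ht with ht | ht | ht
    · exact List.mem_append_left _ ht
    · exact absurd ht hne
    · exact List.mem_append_right _ ht
  · exact ⟨fun a => a, fun _ => rfl, fun _ _ ht => hGsub ht⟩

end Presentation

/-! ### The members of the frontier as presentations -/

theorem mem_labelings {labs : ℕ → List ℕ} {K a : ℕ} (hK : a ≤ K) {t : Fin a → ℕ}
    {l : List (ℕ × ℕ)} : l ∈ labelings labs K (List.ofFn t) ↔
      ∃ c : Fin a → ℕ, (∀ q, c q ∈ labs (t q)) ∧ l = List.ofFn fun q => (t q, c q) := by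
  induction a generalizing K l with
  | zero =>
    have : labelings labs K (List.ofFn t) = [[]] := by
      cases K <;> simp [labelings]
    rw [this]
    constructor
    · intro h
      exact ⟨Fin.elim0, fun q => q.elim0, by simpa using h⟩
    · rintro ⟨c, -, rfl⟩
      simp
  | succ a ih =>
    obtain ⟨K, rfl⟩ : ∃ K', K = K' + 1 := ⟨K - 1, by omega⟩
    rw [List.ofFn_succ]
    simp only [labelings, List.mem_flatMap, List.mem_map, ih (Nat.le_of_succ_le_succ hK)]
    constructor
    · rintro ⟨_, ⟨c, hc, rfl⟩, j, hj, rfl⟩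
      refine ⟨Fin.cons j c, fun q => ?_, ?_⟩
      · refine Fin.cases ?_ (fun q => ?_) q
        · simpa using hj
        · simpa using hc q
      · rw [List.ofFn_succ]
        simp
    · rintro ⟨c, hc, rfl⟩
      exact ⟨_, ⟨fun q => c q.succ, fun q => hc q.succ, rfl⟩, c 0, hc 0, by rw [List.ofFn_succ]⟩

theorem mem_enumerate {F : List RawFact} {j : ℕ} {x : RawFact} :
    (j, x) ∈ enumerate F ↔ F[j]? = some x := by
  rw [enumerate, List.mem_iff_getElem?]
  constructor
  · rintro ⟨i, hi⟩
    rw [List.getElem?_zip_eq_some] at hi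
    obtain ⟨h₁, h₂⟩ := hi
    obtain ⟨_, rfl⟩ := List.getElem?_eq_some_iff.1 h₁
    simpa using h₂
  · intro h
    obtain ⟨hj, -⟩ := List.getElem?_eq_some_iff.1 h
    exact ⟨j, List.getElem?_zip_eq_some.2 ⟨List.getElem?_range hj, h⟩⟩

theorem pairCode_lt {n w : ℕ} {a : Fin n} {c : ℕ} (hc : c < w) : pairCode w (a, c) < n * w := by
  have := Nat.mul_le_mul_right w (Nat.succ_le_of_lt a.2)
  simp only [pairCode]
  rw [Nat.succ_mul] at this
  omega

theorem pairCode_div {w a c : ℕ} (hc : c < w) : pairCode w (a, c) / w = a := by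
  simp only [pairCode]
  rw [Nat.add_comm, Nat.add_mul_div_right _ _ (by omega), Nat.div_eq_of_lt hc, Nat.zero_add]

theorem pairCode_mod {w a c : ℕ} (hc : c < w) : pairCode w (a, c) % w = c := by
  simp only [pairCode]
  rw [Nat.add_comm, Nat.add_mul_mod_self_right, Nat.mod_eq_of_lt hc]

namespace Presentation

variable {S : Schema} {k : ℕ}

/-- The presentation whose facts are the labeled copies of the facts of `P`: its untyped form, and
its facts. -/
theorem exists_relabel (P : Presentation S k) {K w : ℕ} (hK : ∀ r, S.arity r ≤ K) (hw : 0 < w)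
    {labs : ℕ → List ℕ} (hlabs : ∀ a, ∀ c ∈ labs a, c < w) (ok : ℕ → List (ℕ × ℕ) → Bool)
    {ν : Fin k → ℕ} (hν : ∀ i, ν i < w) :
    ∃ R : Presentation S k,
      R.raw = (P.n * w, relabel K w labs ok (enumerate (P.facts.map Schema.Atom.raw)),
        List.ofFn fun i => pairCode w (P.pt i, ν i)) ∧
      R.n = P.n * w ∧ (∀ i, (R.pt i : ℕ) = pairCode w (P.pt i, ν i)) ∧
      ∀ r (t : Fin (S.arity r) → Fin R.n), t ∈ R.toStr.rel r ↔
        ∃ (j : ℕ) (u : Fin (S.arity r) → Fin P.n) (c : Fin (S.arity r) → ℕ),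
          P.facts[j]? = some ⟨r, u⟩ ∧ (∀ q, c q ∈ labs (u q)) ∧
          ok j (List.ofFn fun q => ((u q : ℕ), c q)) = true ∧
          ∀ q, (t q : ℕ) = pairCode w (u q, c q) := by
  have hmem : ∀ x, x ∈ relabel K w labs ok (enumerate (P.facts.map Schema.Atom.raw)) ↔
      ∃ (j : ℕ) (f : S.Atom (Fin P.n)) (c : Fin (S.arity f.1) → ℕ),
        P.facts[j]? = some f ∧ (∀ q, c q ∈ labs (f.2 q)) ∧
        ok j (List.ofFn fun q => ((f.2 q : ℕ), c q)) = true ∧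
        x = ((f.1 : ℕ), List.ofFn fun q => pairCode w (f.2 q, c q)) := by
    intro x
    simp only [relabel, List.mem_flatMap, List.mem_map, List.mem_filter]
    constructor
    · rintro ⟨⟨j, y⟩, hy, l, ⟨hl, hok⟩, rfl⟩
      rw [mem_enumerate, List.getElem?_map, Option.map_eq_some_iff] at hy
      obtain ⟨f, hf, rfl⟩ := hy
      obtain ⟨c, hc, rfl⟩ := (mem_labelings (hK f.1)).1 hl
      refine ⟨j, f, c, hf, hc, hok, ?_⟩
      simp [Schema.Atom.raw, Function.comp_def]
    · rintro ⟨j, f, c, hf, hc, hok, rfl⟩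
      refine ⟨(j, f.raw), ?_, _, ⟨(mem_labelings (hK f.1)).2 ⟨c, hc, rfl⟩, hok⟩, ?_⟩
      · rw [mem_enumerate, List.getElem?_map, hf, Option.map_some]
      · simp [Schema.Atom.raw, Function.comp_def]
  obtain ⟨G, hG⟩ : ∃ G : List (S.Atom (Fin (P.n * w))), G.map Schema.Atom.raw =
      relabel K w labs ok (enumerate (P.facts.map Schema.Atom.raw)) := by
    rw [← Set.mem_range, Set.range_list_map]
    intro x hx
    obtain ⟨j, f, c, -, hc, -, rfl⟩ := (hmem x).1 hx
    exact ⟨⟨f.1, fun q => ⟨_, pairCode_lt (a := f.2 q) (hlabs _ _ (hc q))⟩⟩, rfl⟩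
  refine ⟨⟨P.n * w, Nat.mul_pos P.n_pos hw, G, fun i => ⟨_, pairCode_lt (hν i)⟩⟩,
    by simp only [raw, rawPts, hG], rfl, fun i => rfl, fun r t => ?_⟩
  have h₁ : t ∈ (toStr ⟨P.n * w, Nat.mul_pos P.n_pos hw, G,
      fun i => ⟨_, pairCode_lt (hν i)⟩⟩ : Str S k).rel r ↔
      Schema.Atom.raw (⟨r, t⟩ : S.Atom (Fin (P.n * w))) ∈ G.map Schema.Atom.raw :=
    (List.mem_map_of_injective Schema.Atom.raw_injective).symm
  rw [h₁, hG, hmem]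
  constructor
  · rintro ⟨j, ⟨r', u⟩, c, hj, hc, hok, h⟩
    simp only [Schema.Atom.raw, Prod.mk.injEq] at h
    obtain rfl := Fin.ext h.1
    exact ⟨j, u, c, hj, hc, hok, congrFun (List.ofFn_injective h.2)⟩
  · rintro ⟨j, u, c, hj, hc, hok, h⟩
    exact ⟨j, ⟨r, u⟩, c, hj, hc, hok, by simp only [Schema.Atom.raw, h]⟩

/-- The untyped members of the first part of the frontier present the split copies. -/
theorem exists_split (P : Presentation S k) {K : ℕ} (hK : ∀ r, S.arity r ≤ K) (τ : Fin k → Bool) :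
    ∃ R : Presentation S k,
      R.raw = (P.n * 2, relabel K 2 (fun _ => [0, 1]) (fun _ _ => true)
        (enumerate (P.facts.map Schema.Atom.raw)),
        List.ofFn fun i => pairCode 2 (P.pt i, (τ i).toNat)) ∧
      (P.toStr.split τ).MapsTo R.toStr ∧ R.toStr.MapsTo (P.toStr.split τ) := by
  have hlt : ∀ b : Bool, b.toNat < 2 := by decide
  obtain ⟨R, hR, hn, hpt, hrel⟩ := P.exists_relabel hK two_pos (labs := fun _ => [0, 1])
    (by simp) (fun _ _ => true) (ν := fun i => (τ i).toNat) fun i => hlt _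
  refine ⟨R, hR, ⟨fun x : Fin P.n × Bool => (⟨pairCode 2 (x.1, x.2.toNat),
    hn ▸ pairCode_lt (hlt _)⟩ : Fin R.n), fun i => Fin.ext (hpt i).symm, fun r t ht => ?_⟩,
    fun x : Fin R.n => ((⟨x / 2, Nat.div_lt_of_lt_mul
      (x.2.trans_eq (hn.trans (Nat.mul_comm _ _)))⟩ : Fin P.n), (x : ℕ) % 2 == 1),
    fun i => ?_, fun r (t : Fin (S.arity r) → Fin R.n) ht => ?_⟩
  · obtain ⟨j, hj⟩ := List.mem_iff_getElem?.1 (show _ ∈ P.facts from ht)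
    refine (hrel r _).2 ⟨j, _, fun q => (t q).2.toNat, hj, fun q => ?_, rfl, fun q => rfl⟩
    cases (t q).2 <;> simp
  · refine Prod.ext (Fin.ext ?_) ?_
    · exact (congrArg (· / 2) (hpt i)).trans (pairCode_div (hlt _))
    · have : (R.pt i : ℕ) % 2 = (τ i).toNat :=
        (congrArg (· % 2) (hpt i)).trans (pairCode_mod (hlt _))
      change ((R.pt i : ℕ) % 2 == 1) = τ i
      rw [this]
      cases τ i <;> rfl
  · obtain ⟨j, u, c, hj, hc, -, ht⟩ := (hrel r t).1 ht
    have hc' : ∀ q, c q < 2 := fun q => by have := hc q; simp at this; omega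
    have hu : (fun q => (⟨(t q : ℕ) / 2, Nat.div_lt_of_lt_mul
        ((t q).2.trans_eq (hn.trans (Nat.mul_comm _ _)))⟩ : Fin P.n)) = u := funext fun q =>
      Fin.ext ((congrArg (· / 2) (ht q)).trans (pairCode_div (hc' q)))
    exact (congrArg (fun u => (⟨r, u⟩ : S.Atom (Fin P.n)) ∈ P.facts) hu).mpr
      (List.mem_of_getElem? hj)

/-- The fact with a given position, or `none` if there are not that many facts. -/
def label (P : Presentation S k) (c : ℕ) : Option P.toStr.Fact :=
  if h : c < P.facts.length then some ⟨P.facts[c], List.getElem_mem h⟩ else none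

theorem label_eq_none {P : Presentation S k} {c : ℕ} :
    P.label c = none ↔ P.facts.length ≤ c := by
  simp [label]

theorem label_eq_some {P : Presentation S k} {c : ℕ} {f : P.toStr.Fact} :
    P.label c = some f ↔ P.facts[c]? = some f.1 := by
  rw [label]
  split
  · next h =>
    rw [List.getElem?_eq_getElem h]
    exact ⟨fun e => congrArg (fun x => some x.1) (Option.some_injective _ e),
      fun e => congrArg some (Subtype.ext (Option.some_injective _ e))⟩
  · next h =>
    rw [List.getElem?_eq_none (not_lt.1 h)]
    simp

theorem label_surjective (P : Presentation S k) (o : Option P.toStr.Fact) :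
    ∃ c ≤ P.facts.length, P.label c = o := by
  cases o with
  | none => exact ⟨_, le_rfl, label_eq_none.2 le_rfl⟩
  | some f =>
    obtain ⟨c, hc⟩ := List.mem_iff_getElem?.1 (show f.1 ∈ P.facts from f.2)
    obtain ⟨hlt, -⟩ := List.getElem?_eq_some_iff.1 hc
    exact ⟨c, hlt.le, label_eq_some.2 hc⟩

theorem label_injOn {P : Presentation S k} (hP : P.facts.Nodup) {c c' : ℕ}
    (hc : c ≤ P.facts.length) (hc' : c' ≤ P.facts.length) (h : P.label c = P.label c') :
    c = c' := by
  cases h' : P.label c' with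
  | none =>
    exact (hc.antisymm (label_eq_none.1 (h.trans h'))).trans
      (hc'.antisymm (label_eq_none.1 h')).symm
  | some f =>
    have h₁ := label_eq_some.1 (h.trans h')
    have h₂ := label_eq_some.1 h'
    obtain ⟨l₁, -⟩ := List.getElem?_eq_some_iff.1 h₁
    exact (List.getElem?_inj l₁ hP).1 (h₁.trans h₂.symm)

theorem mem_factLabels {P : Presentation S k} {a : Fin P.n} {c : ℕ} :
    c ∈ factLabels (P.facts.map Schema.Atom.raw) a ↔
      c ≤ P.facts.length ∧ ∀ g, P.label c = some g → P.toStr.Occurs a g := by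
  simp only [factLabels, List.mem_cons, List.length_map, List.mem_map, List.mem_filter,
    List.contains_iff_mem]
  constructor
  · rintro (rfl | ⟨⟨c, x⟩, ⟨hx, ha⟩, rfl⟩)
    · refine ⟨le_rfl, fun g hg => ?_⟩
      rw [label_eq_none.2 le_rfl] at hg
      simp at hg
    · rw [mem_enumerate, List.getElem?_map, Option.map_eq_some_iff] at hx
      obtain ⟨f, hf, rfl⟩ := hx
      obtain ⟨hlt, -⟩ := List.getElem?_eq_some_iff.1 hf
      refine ⟨hlt.le, fun g hg => ?_⟩
      obtain rfl := Option.some_injective _ (hf.symm.trans (label_eq_some.1 hg))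
      obtain ⟨q, hq⟩ := List.mem_ofFn.1 ha
      exact ⟨q, Fin.ext hq⟩
  · rintro ⟨hc, h⟩
    cases hl : P.label c with
    | none => exact .inl (hc.antisymm (label_eq_none.1 hl))
    | some f =>
      obtain ⟨q, hq⟩ := h f hl
      refine .inr ⟨(c, Schema.Atom.raw (f.1 : S.Atom (Fin P.n))), ⟨?_, ?_⟩, rfl⟩
      · rw [mem_enumerate, List.getElem?_map, label_eq_some.1 hl]
        rfl
      · exact List.mem_ofFn.2 ⟨q, congrArg Fin.val hq⟩

/-- The test on labels that the program performs expresses admissibility. -/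
theorem okLabels_iff {P : Presentation S k} (hP : P.facts.Nodup) {j₀ j : ℕ}
    {f₀ : P.toStr.Fact} {r : Fin S.numRel} {u : Fin (S.arity r) → Fin P.n}
    (hu : u ∈ P.toStr.rel r) (hj₀ : P.label j₀ = some f₀) (hj : P.label j = some ⟨⟨r, u⟩, hu⟩)
    {c : Fin (S.arity r) → ℕ} :
    ((∀ q, c q ∈ factLabels (P.facts.map Schema.Atom.raw) (u q)) ∧
      okLabels P.rawPts P.facts.length j₀ j (List.ofFn fun q => ((u q : ℕ), c q)) = true) ↔
      (∀ q, c q ≤ P.facts.length) ∧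
        P.toStr.Admissible f₀ ⟨⟨r, u⟩, hu⟩ fun q => P.label (c q) := by
  simp only [mem_factLabels, forall_and, and_assoc, Str.Admissible]
  refine and_congr_right fun hc => and_congr_right fun _ => ?_
  have hlt : ∀ {i g}, P.label i = some g → i ≤ P.facts.length := fun {i g} h => by
    obtain ⟨hlt, -⟩ := List.getElem?_eq_some_iff.1 (label_eq_some.1 h)
    exact hlt.le
  have h₁ : ∀ q, c q = P.facts.length ↔ P.label (c q) = none := fun q => by
    rw [label_eq_none]
    exact ⟨fun h => h.ge, fun h => (hc q).antisymm h⟩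
  have h₂ : j = j₀ ↔ (⟨⟨r, u⟩, hu⟩ : P.toStr.Fact) = f₀ := by
    constructor
    · rintro rfl
      exact Option.some_injective _ (hj.symm.trans hj₀)
    · rintro rfl
      exact label_injOn hP (hlt hj) (hlt hj₀) (hj.trans hj₀.symm)
  have h₃ : ∀ q, c q = j ↔ P.label (c q) = some ⟨⟨r, u⟩, hu⟩ := fun q => by
    constructor
    · rintro rfl
      exact hj
    · exact fun h => label_injOn hP (hc q) (hlt hj) (h.trans hj.symm)
  have h₄ : ∀ q, (u q : ℕ) ∈ P.rawPts ↔ P.toStr.IsPt (u q) :=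
    fun q => mem_rawPts
  simp only [okLabels, Bool.or_eq_true, Bool.and_eq_true, List.any_eq_true, List.all_eq_true,
    List.mem_ofFn, List.contains_iff_mem, Bool.not_eq_true', beq_iff_eq,
    exists_exists_eq_and, forall_exists_index, forall_apply_eq_imp_iff, ne_eq,
    ← Bool.not_eq_true, h₁, h₂, h₃, h₄]
  simp only [or_iff_not_imp_left]
  rfl

/-- The untyped members of the second part of the frontier present the obstructed copies. -/
theorem exists_obstructed (P : Presentation S k) (hP : P.facts.Nodup) {K : ℕ}
    (hK : ∀ r, S.arity r ≤ K) {j₀ : ℕ} {f₀ : P.toStr.Fact} (hj₀ : P.label j₀ = some f₀) :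
    ∃ R : Presentation S k,
      R.raw = (P.n * (P.facts.length + 1), relabel K (P.facts.length + 1)
        (factLabels (P.facts.map Schema.Atom.raw)) (okLabels P.rawPts P.facts.length j₀)
        (enumerate (P.facts.map Schema.Atom.raw)),
        List.ofFn fun i => pairCode (P.facts.length + 1) (P.pt i, P.facts.length)) ∧
      (P.toStr.obstructed f₀).MapsTo R.toStr ∧ R.toStr.MapsTo (P.toStr.obstructed f₀) := by
  set m := P.facts.length with hm
  have hlabs : ∀ a, ∀ c ∈ factLabels (P.facts.map Schema.Atom.raw) a, c < m + 1 := by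
    intro a c hc
    simp only [factLabels, List.mem_cons, List.length_map, List.mem_map, List.mem_filter] at hc
    rcases hc with rfl | ⟨⟨c, x⟩, ⟨hx, -⟩, rfl⟩
    · omega
    · rw [mem_enumerate] at hx
      obtain ⟨hlt, -⟩ := List.getElem?_eq_some_iff.1 hx
      rw [List.length_map] at hlt
      exact hlt.trans (Nat.lt_succ_self _)
  obtain ⟨R, hR, hn, hpt, hrel⟩ := P.exists_relabel hK (Nat.succ_pos m) hlabs
    (okLabels P.rawPts m j₀) (ν := fun _ => m) fun _ => Nat.lt_succ_self m
  choose num hnum hlabel using P.label_surjective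
  have hlt : ∀ o, num o < m + 1 := fun o => Nat.lt_succ_of_le (hnum o)
  have hdiv : ∀ x : Fin R.n, (x : ℕ) / (m + 1) < P.n := fun x => Nat.div_lt_of_lt_mul
    (x.2.trans_eq (hn.trans (Nat.mul_comm _ _)))
  refine ⟨R, hR, ⟨fun x : Fin P.n × Option P.toStr.Fact => (⟨pairCode (m + 1) (x.1, num x.2),
    hn ▸ pairCode_lt (hlt _)⟩ : Fin R.n), fun i => Fin.ext ?_, fun r t ht => ?_⟩,
    fun x : Fin R.n => ((⟨x / (m + 1), hdiv x⟩ : Fin P.n), P.label (x % (m + 1))),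
    fun i => ?_, fun r (t : Fin (S.arity r) → Fin R.n) ht => ?_⟩
  · have : num none = m := (hnum none).antisymm (label_eq_none.1 (hlabel none))
    refine (congrArg (fun c => pairCode (m + 1) (P.pt i, c)) this).trans (hpt i).symm
  · obtain ⟨hu, hadm⟩ := ht
    obtain ⟨j, hj⟩ := List.mem_iff_getElem?.1 (show _ ∈ P.facts from hu)
    have h := (okLabels_iff hP hu hj₀ (label_eq_some.2 hj)
      (c := fun q => num (t q).2)).2 ⟨fun q => hnum _, by simpa only [hlabel] using hadm⟩
    exact (hrel r _).2 ⟨j, _, fun q => num (t q).2, hj, h.1, h.2, fun q => rfl⟩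
  · refine Prod.ext (Fin.ext ?_) ?_
    · exact (congrArg (· / (m + 1)) (hpt i)).trans (pairCode_div (Nat.lt_succ_self m))
    · have : (R.pt i : ℕ) % (m + 1) = m :=
        (congrArg (· % (m + 1)) (hpt i)).trans (pairCode_mod (Nat.lt_succ_self m))
      exact (congrArg P.label this).trans (label_eq_none.2 le_rfl)
  · obtain ⟨j, u, c, hj, hc, hok, ht⟩ := (hrel r t).1 ht
    have hu : (⟨r, u⟩ : S.Atom (Fin P.n)) ∈ P.facts := List.mem_of_getElem? hj
    have h := ((okLabels_iff hP hu hj₀ (label_eq_some.2 hj) (c := c)).1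
      ⟨hc, hok⟩).2
    have hlt' : ∀ q, c q < m + 1 := fun q => hlabs _ _ (hc q)
    obtain rfl : (fun q => (⟨(t q : ℕ) / (m + 1), hdiv (t q)⟩ : Fin P.n)) = u := funext fun q =>
      Fin.ext ((congrArg (· / (m + 1)) (ht q)).trans (pairCode_div (hlt' q)))
    obtain rfl : (fun q => (t q : ℕ) % (m + 1)) = c := funext fun q =>
      (congrArg (· % (m + 1)) (ht q)).trans (pairCode_mod (hlt' q))
    exact ⟨hu, h⟩

end Presentation

/-! ### Correctness of the algorithm -/

namespace Presentation

variable {S : Schema} {k : ℕ}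

theorem mem_splitPart {Q : Presentation S k} {K : ℕ} {x : RawStr} :
    x ∈ splitPart K k Q.n (Q.facts.map Schema.Atom.raw) Q.rawPts ↔
      ∃ τ : Fin k → Bool, (∃ i j, Q.pt i = Q.pt j ∧ τ i ≠ τ j) ∧
        x = (Q.n * 2, relabel K 2 (fun _ => [0, 1]) (fun _ _ => true)
          (enumerate (Q.facts.map Schema.Atom.raw)),
          List.ofFn fun i => pairCode 2 (Q.pt i, (τ i).toNat)) := by
  have htest : ∀ τ : Fin k → Bool,
      ((List.ofFn fun i => ((Q.pt i : ℕ), (τ i).toNat)).any fun x =>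
        (List.ofFn fun i => ((Q.pt i : ℕ), (τ i).toNat)).any fun y =>
          x.1 == y.1 && !(x.2 == y.2)) = true ↔ ∃ i j, Q.pt i = Q.pt j ∧ τ i ≠ τ j := by
    intro τ
    have hinj : ∀ b b' : Bool, b.toNat = b'.toNat ↔ b = b' := by decide
    simp [List.any_eq_true, List.mem_ofFn, Fin.ext_iff, hinj]
  simp only [splitPart, List.mem_map, List.mem_filter, rawPts, mem_labelings le_rfl]
  constructor
  · rintro ⟨_, ⟨⟨c, hc, rfl⟩, hl⟩, rfl⟩
    have hcτ : c = fun i => (c i == 1).toNat := by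
      funext i
      have := hc i
      simp only [List.mem_cons, List.not_mem_nil, or_false] at this
      rcases this with h | h <;> simp [h]
    rw [hcτ] at hl ⊢
    exact ⟨_, (htest fun i => c i == 1).1 hl, by simp [Function.comp_def]⟩
  · rintro ⟨τ, hτ, rfl⟩
    refine ⟨_, ⟨⟨fun i => (τ i).toNat, fun i => ?_, rfl⟩, (htest τ).2 hτ⟩, ?_⟩
    · cases τ i <;> simp
    · simp [Function.comp_def]

theorem mem_obstructedPart {Q : Presentation S k} {K : ℕ} {x : RawStr} :
    x ∈ obstructedPart K Q.n (Q.facts.map Schema.Atom.raw) Q.rawPts ↔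
      ∃ (j₀ : ℕ) (f₀ : Q.toStr.Fact), Q.label j₀ = some f₀ ∧
        x = (Q.n * (Q.facts.length + 1), relabel K (Q.facts.length + 1)
          (factLabels (Q.facts.map Schema.Atom.raw)) (okLabels Q.rawPts Q.facts.length j₀)
          (enumerate (Q.facts.map Schema.Atom.raw)),
          List.ofFn fun i => pairCode (Q.facts.length + 1) (Q.pt i, Q.facts.length)) := by
  simp only [obstructedPart, List.mem_map, List.length_map, List.mem_range]
  constructor
  · rintro ⟨j₀, hj₀, rfl⟩
    refine ⟨j₀, ⟨Q.facts[j₀], List.getElem_mem hj₀⟩,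
      label_eq_some.2 (List.getElem?_eq_getElem hj₀), ?_⟩
    simp [rawPts, Function.comp_def]
  · rintro ⟨j₀, f₀, hj₀, rfl⟩
    obtain ⟨hlt, -⟩ := List.getElem?_eq_some_iff.1 (label_eq_some.1 hj₀)
    exact ⟨j₀, hlt, by simp [rawPts, Function.comp_def]⟩

/-- The output of the algorithm describes a frontier. -/
theorem exists_frontier {P : Presentation S k} (hP : P.toStr.CAcyclic) {K : ℕ}
    (hK : ∀ r, S.arity r ≤ K) :
    ∃ L : List (Presentation S k), L.map raw = rawFrontier K k P.raw ∧
      Str.IsFrontier Set.univ {B | ∃ Q ∈ L, B = Q.toStr} P.toStr := by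
  obtain ⟨G, hcore, hnodup, hforest, hmin, hPQ, hQP⟩ := exists_core hP.isForest
  set Q := P.withFacts G
  have hraw : rawFrontier K k P.raw =
      splitPart K k Q.n (Q.facts.map Schema.Atom.raw) Q.rawPts ++
        obstructedPart K Q.n (Q.facts.map Schema.Atom.raw) Q.rawPts := by
    simp only [rawFrontier, raw, hcore]
    rfl
  have h₁ : ∀ x ∈ rawFrontier K k P.raw, ∃ R : Presentation S k, R.raw = x ∧
      ∃ B ∈ {B | ∃ τ : Fin k → Bool, (∃ i j, Q.toStr.pt i = Q.toStr.pt j ∧ τ i ≠ τ j) ∧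
        B = Q.toStr.split τ} ∪ {B | ∃ f₀, B = Q.toStr.obstructed f₀},
        B.MapsTo R.toStr ∧ R.toStr.MapsTo B := by
    intro x hx
    rw [hraw, List.mem_append, mem_splitPart, mem_obstructedPart] at hx
    rcases hx with ⟨τ, hτ, rfl⟩ | ⟨j₀, f₀, hj₀, rfl⟩
    · obtain ⟨R, hR, h⟩ := Q.exists_split hK τ
      exact ⟨R, hR, _, .inl ⟨τ, hτ, rfl⟩, h⟩
    · obtain ⟨R, hR, h⟩ := Q.exists_obstructed hnodup hK hj₀
      exact ⟨R, hR, _, .inr ⟨f₀, rfl⟩, h⟩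
  obtain ⟨L, hL⟩ : ∃ L : List (Presentation S k), L.map raw = rawFrontier K k P.raw := by
    rw [← Set.mem_range, Set.range_list_map]
    exact fun x hx => (h₁ x hx).imp fun R h => h.1
  have hmem : ∀ R : Presentation S k, R ∈ L ↔ R.raw ∈ rawFrontier K k P.raw := fun R => by
    rw [← hL, List.mem_map_of_injective raw_injective]
  refine ⟨L, hL, (hforest.isFrontier hmin).congr hQP hPQ ?_ ?_⟩
  · rintro _ (⟨τ, hτ, rfl⟩ | ⟨f₀, rfl⟩)
    · obtain ⟨R, hR, h, -⟩ := Q.exists_split hK τ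
      refine ⟨_, ⟨R, (hmem R).2 ?_, rfl⟩, h⟩
      rw [hraw, List.mem_append, mem_splitPart]
      exact .inl ⟨τ, hτ, hR⟩
    · obtain ⟨j₀, -, hj₀⟩ := Q.label_surjective (some f₀)
      obtain ⟨R, hR, h, -⟩ := Q.exists_obstructed hnodup hK hj₀
      refine ⟨_, ⟨R, (hmem R).2 ?_, rfl⟩, h⟩
      rw [hraw, List.mem_append, mem_obstructedPart]
      exact .inr ⟨j₀, f₀, hj₀, hR⟩
  · rintro _ ⟨R, hR, rfl⟩
    obtain ⟨R', hR', B, hB, h⟩ := h₁ _ ((hmem R).1 hR)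
    obtain rfl := raw_injective hR'
    exact ⟨B, hB, h⟩

end Presentation

/-- For every schema and every `k` there are a program and a polynomial such that, on every
c-acyclic structure with `k` distinguished elements, the program halts within polynomially many
steps and outputs a (finite list of structures that forms a) frontier with respect to the class of
all structures with `k` distinguished elements. -/
theorem theorem3p4 (S : Schema) (k : ℕ) :
    ∃ (prog : Program) (bound : Polynomial ℕ),
      ∀ P : Presentation S k, P.toStr.CAcyclic →
        ∃ (L : List (Presentation S k)) (t : ℕ),
          prog.Runs P.encode (Data.ofList (L.map Presentation.encode)) t ∧
          t ≤ bound.eval P.encode.size ∧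
          Str.IsFrontier Set.univ {B | ∃ Q ∈ L, B = Q.toStr} P.toStr := by
  let K := Finset.univ.sup S.arity
  obtain ⟨prog, bound, h⟩ := PolyTime.rawFrontier K k
  refine ⟨prog, bound, fun P hP => ?_⟩
  obtain ⟨L, hL, hF⟩ := Presentation.exists_frontier hP (K := K)
    fun r => Finset.le_sup (f := S.arity) (Finset.mem_univ r)
  obtain ⟨t, ht, hbound⟩ := h P.raw
  have hout : toData (rawFrontier K k P.raw) = Data.ofList (L.map Presentation.encode) := by
    rw [← hL]
    change Data.ofList ((L.map Presentation.raw).map toData) = _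
    rw [List.map_map]
    exact congrArg _ (List.map_congr_left fun Q _ => Q.encode_eq.symm)
  refine ⟨L, t, ?_, ?_, hF⟩
  · rw [← hout, P.encode_eq]
    exact ht
  · rw [P.encode_eq]
    exact hbound
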